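/- All graphs are finite and simple. Let $S=(s_1,s_2,s_3,\dots)$ be a non-decreasing sequence of positive integers. An $S$-packing $k$-coloring of a graph $G$ is a map $c:V(G)\to\{1,\dots,k\}$ such that $u\ne v$ and $c(u)=c(v)=i$ imply $d_G(u,v)>s_i$, where $d_G(u,v)=\infty$ if $u$ and $v$ lie in different components. Let $\chi_S(G)$ be the smallest $k$ for which $G$ has an $S$-packing $k$-coloring. The graph $G$ is $4$-$\chi_S$-vertex-critical if $\chi_S(G)=4$ and $\chi_S(G-u)<\chi_S(G)$ for every $u\in V(G)$. Define the following graphs. - $H_1$: two triangles sharing exactly one edge, with a pendant vertex attached to one of the two vertices of degree $2$. - $H_2$: two triangles sharing exactly one vertex. - $H_3$: a triangle with one pendant vertex attached to each of its vertices. - $H_4$: the graph with vertices $a,b,c,d,e$ and edges $ab,bc,ca,bd,de$. - $H_5$: a $4$-cycle with one pendant vertex attached to each of two adjacent vertices. - $H_7$: the graph $K_{2,3}$ with a pendant vertex attached to one of its vertices of degree $2$. - $H_{14}$: the path $abcde$ with one pendant vertex attached to $c$ and one pendant vertex attached to $d$. - $H_{15}$: a $4$-cycle $abcd$, a vertex $e$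 adjacent to $c$, and two pendant vertices attached to $e$. - $\mathcal C_5$: the four graphs (up to isomorphism) obtained from the cycle $v_0v_1v_2v_3v_4$ by adding the set of chords $\{v_0v_2\}$, $\{v_0v_2,v_0v_3\}$, $\{v_0v_2,v_1v_3\}$, or $\{v_0v_2,v_0v_3,v_1v_4\}$. - $\mathcal C_6$: the three graphs (up to isomorphism) obtained from the cycle $v_0v_1v_2v_3v_4v_5$ by adding the set of chords $\{v_0v_3\}$, $\{v_0v_3,v_1v_4\}$, or $\{v_0v_3,v_1v_4,v_2v_5\}$. - $G_{2k}$, for $k\ge 3$: the graph obtained from the path $v_1v_2\cdots v_{2k}$ by attaching one pendant vertex to $v_2$ and one pendant vertex to $v_{2k-1}$. **Statement.** Let $S=(s_1,s_2,s_3,s_4,\dots)$ be a non-decreasing sequence of positive integers with $s_1=1$, $s_2=s_3=3$. Then a graph $G$ is $4$-$\chi_S$-vertex-critical if and only if $G$ is isomorphic to one of the following: - $K_4$; - one of $H_1,H_2,H_3,H_4,H_5,H_7,H_{14},H_{15}$; - a graph from $\mathcal C_5\cup\mathcal C_6$; - a cycle $C_n$ with $n\ge 5$ such that $n\equiv 1,2\pmod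 4$, or $n\equiv 3\pmod 4$ and $s_4<\lfloor n/2\rfloor$; - a graph $G_{2k}$ with $k\ge 3$. -/

import Mathlib

/-- A packing sequence `S = (s₁, s₂, s₃, …)`: a non-decreasing sequence of positive integers.
Indices start at zero: `s i` is the term `s_{i+1}`. -/
def IsPackingSequence (s : ℕ → ℕ) : Prop :=
  Monotone s ∧ ∀ i, 0 < s i

/-- `c` is an `S`-packing `k`-coloring of `G`: distinct vertices of the same color `i` are at
distance more than `s i`. Distances take values in `ℕ∞`, and vertices in different components are
at distance `⊤`. The colors are `0, …, k - 1`, in accordance with the indexing of `s`. -/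
def IsSPackingColoring {V : Type*} (s : ℕ → ℕ) (G : SimpleGraph V) (k : ℕ) (c : V → Fin k) :
    Prop :=
  ∀ u v : V, u ≠ v → c u = c v → (s (c u) : ℕ∞) < G.edist u v

/-- The `S`-packing chromatic number `χ_S(G)`: the smallest `k` such that `G` admits an
`S`-packing `k`-coloring (`⊤` if there is no such `k`, which cannot happen for a finite graph). -/
noncomputable def sPackingChromaticNumber {V : Type*} (s : ℕ → ℕ) (G : SimpleGraph V) : ℕ∞ :=
  ⨅ k ∈ {k : ℕ | ∃ c : V → Fin k, IsSPackingColoring s G k c}, (k : ℕ∞)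

/-- `G` is `χ_S`-vertex-critical: `χ_S(G - u) < χ_S(G)` for every vertex `u`. -/
def IsSVertexCritical {V : Type*} (s : ℕ → ℕ) (G : SimpleGraph V) : Prop :=
  ∀ u : V, sPackingChromaticNumber s (G.induce {u}ᶜ) < sPackingChromaticNumber s G

/-- `G` is `k`-`χ_S`-vertex-critical. -/
def IsKSVertexCritical {V : Type*} (s : ℕ → ℕ) (k : ℕ) (G : SimpleGraph V) : Prop :=
  IsSVertexCritical s G ∧ sPackingChromaticNumber s G = k

/-- The graph on `Fin n` with the given list of edges. -/
def graphOfEdges (n : ℕ) (E : List (Fin n × Fin n)) : SimpleGraph (Fin n) :=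
  SimpleGraph.fromRel fun u v => (u, v) ∈ E

/-- The triangles `0 1 3` and `1 2 3` sharing the edge `1 3`, with a pendant vertex `4` attached
to `2`, one of the two vertices of degree two. -/
def graphH1 : SimpleGraph (Fin 5) :=
  graphOfEdges 5 [(0, 1), (1, 2), (2, 3), (3, 0), (1, 3), (2, 4)]

/-- Two triangles sharing exactly one vertex. -/
def graphH2 : SimpleGraph (Fin 5) :=
  graphOfEdges 5 [(0, 1), (1, 2), (2, 0), (2, 3), (3, 4), (4, 2)]

/-- A triangle with one pendant vertex attached to each of its three vertices. -/
def graphH3 : SimpleGraph (Fin 6) :=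
  graphOfEdges 6 [(0, 1), (1, 2), (2, 0), (0, 3), (1, 4), (2, 5)]

/-- A triangle `0 1 2` with a path `1 3 4` attached to one of its vertices. -/
def graphH4 : SimpleGraph (Fin 5) :=
  graphOfEdges 5 [(0, 1), (1, 2), (2, 0), (1, 3), (3, 4)]

/-- A four-cycle `0 1 2 3` with one pendant vertex attached to each of two adjacent vertices. -/
def graphH5 : SimpleGraph (Fin 6) :=
  graphOfEdges 6 [(0, 1), (1, 2), (2, 3), (3, 0), (2, 4), (1, 5)]

/-- The complete bipartite graph with parts `{1, 3}` and `{0, 2, 5}`, and a pendant vertex `4`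
attached to the vertex `2` of degree two. -/
def graphH7 : SimpleGraph (Fin 6) :=
  graphOfEdges 6 [(0, 1), (1, 2), (2, 3), (3, 0), (1, 5), (3, 5), (2, 4)]

/-- The path `0 1 2 3 4` with a pendant vertex `5` attached to `2` and a pendant vertex `6`
attached to `3`. -/
def graphH14 : SimpleGraph (Fin 7) :=
  graphOfEdges 7 [(0, 1), (1, 2), (2, 3), (3, 4), (2, 5), (3, 6)]

/-- A four-cycle `0 1 2 3`, a vertex `4` adjacent to `2`, and two pendant vertices `5`, `6`
attached to `4`. -/
def graphH15 : SimpleGraph (Fin 7) :=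
  graphOfEdges 7 [(0, 1), (1, 2), (2, 3), (3, 0), (2, 4), (4, 5), (4, 6)]

/-- The family `𝒞₅` of four graphs of order five: the five-cycle `0 1 2 3 4` together with one
chord; with two chords that share an end; with two chords that share no end; with three chords
such that the two remaining chords share no end (the wheel with four spokes and hub `0`). Up to
isomorphism these are the graphs without `K₄` obtained from a five-cycle by adding at least one
chord. -/
def familyC5 : Set (SimpleGraph (Fin 5)) :=
  {graphOfEdges 5 [(0, 1), (1, 2), (2, 3), (3, 4), (4, 0), (0, 2)],
    graphOfEdges 5 [(0, 1), (1, 2), (2, 3), (3, 4), (4, 0), (0, 2), (0, 3)],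
    graphOfEdges 5 [(0, 1), (1, 2), (2, 3), (3, 4), (4, 0), (0, 2), (1, 3)],
    graphOfEdges 5 [(0, 1), (1, 2), (2, 3), (3, 4), (4, 0), (0, 2), (0, 3), (1, 4)]}

/-- The family `𝒞₆` of three graphs of order six: the six-cycle `0 1 2 3 4 5` together with one,
two or three long diagonals. -/
def familyC6 : Set (SimpleGraph (Fin 6)) :=
  {graphOfEdges 6 [(0, 1), (1, 2), (2, 3), (3, 4), (4, 5), (5, 0), (0, 3)],
    graphOfEdges 6 [(0, 1), (1, 2), (2, 3), (3, 4), (4, 5), (5, 0), (0, 3), (1, 4)],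
    graphOfEdges 6 [(0, 1), (1, 2), (2, 3), (3, 4), (4, 5), (5, 0), (0, 3), (1, 4), (2, 5)]}

/-- The graph `G_{2k}`: the path `v₁ v₂ … v_{2k}` with a pendant vertex attached to each of its
two support vertices `v₂` and `v_{2k-1}`. Here `Sum.inl i` is `v_{i+1}`, and `Sum.inr false` and
`Sum.inr true` are the pendant vertices at `v₂` and at `v_{2k-1}`. -/
def graphG (k : ℕ) : SimpleGraph (Fin (2 * k) ⊕ Bool) :=
  SimpleGraph.fromRel fun x y =>
    match x, y with
    | Sum.inl i, Sum.inl j => i.val + 1 = j.val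
    | Sum.inl i, Sum.inr false => i.val + 1 = 2
    | Sum.inl i, Sum.inr true => i.val + 1 = 2 * k - 1
    | Sum.inr _, _ => False

/-! Colors are numbered from `0`: color `0` has radius one, colors `1` and `2` have radius three.
Criticality amounts to three conditions: there is no three-coloring, every vertex deletion has one,
and the whole graph has a four-coloring. Only the last involves `s 3`. It is free when some deletion
coloring respects the distances of the whole graph, because the deleted vertex then takes the fourth
color alone. Among the graphs to be considered this fails only for cycles of order `3` modulo `4`.
There counting gives at most `n - 2` vertices to the first three colors, so two vertices share the
fourth color and `s 3 < n / 2` is forced.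

For the classification, call a graph packable if it has a `(1, 3, 3)`-coloring. If a nonpackable
graph embeds in a critical graph, the embedding reaches every vertex, since otherwise a vertex
deletion would be nonpackable (`IsPackingCritical.surjective`). So it suffices to find a known
nonpackable subgraph in every critical graph. The critical graph is then that subgraph with extra
edges on the same vertices, and most extra edges are excluded because they create a smaller
nonpackable subgraph.

With a triangle present, either `graphH4` embeds or all edges meet the triangle. In the latter case
two triangle vertices cover all edges, or the triangle extends to `graphH3` or to a complete graph
on four vertices.

Without triangles, a cycle of order at least five and not divisible by four is nonpackable and hence
spanning. A chord splits it into two cycles whose orders must be divisible by four, and this leaves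
only chords of the six-cycle. Without such a cycle either, the distance levels from any root `r`
form a bipartition. Giving color `0` to odd levels and alternating the other colors on even levels
works unless some vertex at odd distance from `r` has three neighbors (`packable_of_odd_levels`).
Using this twice yields two vertices with three neighbors at odd distance from each other. At
distance one they lead to `graphH5`, `graphH14` or a graph covered by two vertices. At larger
distance a geodesic between them with its spare end neighbors is a copy of `graphG k`, and any
further edge would give a smaller nonpackable subgraph or an excluded cycle. -/

/-- `c` is a `(1, 3, 3)`-packing coloring, phrased through the absence of short walks. -/
def IsPacking133 {V : Type*} (G : SimpleGraph V) (c : V → Fin 3) : Prop :=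
  ∀ u v, u ≠ v → c u = c v → ¬ G.Adj u v ∧
    (c u ≠ 0 → ∀ w, G.Adj u w → ¬ G.Adj w v ∧ ∀ x, G.Adj w x → ¬ G.Adj x v)

/-- `G` admits a `(1, 3, 3)`-packing coloring. -/
def Packable {V : Type*} (G : SimpleGraph V) : Prop :=
  ∃ c, IsPacking133 G c

/-! ### Distances expressed through short walks -/

section Distance

variable {V : Type*} {G : SimpleGraph V}

theorem natCast_lt_edist_iff {u v : V} {k : ℕ} :
    (k : ℕ∞) < G.edist u v ↔ ∀ p : G.Walk u v, k < p.length := by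
  unfold SimpleGraph.edist
  rw [← Order.add_one_le_iff_of_not_isMax (by simp), le_iInf_iff]
  refine forall_congr' fun p => ?_
  norm_cast

theorem one_lt_edist_iff {u v : V} (h : u ≠ v) :
    ((1 : ℕ) : ℕ∞) < G.edist u v ↔ ¬ G.Adj u v := by
  rw [natCast_lt_edist_iff]
  constructor
  · intro H hadj
    have := H hadj.toWalk
    simp at this
  · intro H p
    match p with
    | .nil => exact absurd rfl h
    | .cons h1 .nil => exact absurd h1 H
    | .cons _ (.cons _ q) => simp

/-- Enumerating walks of length at most three replaces distance by adjacency alone. This form is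
decidable on concrete graphs and transfers along edge-preserving injections. -/
theorem three_lt_edist_iff {u v : V} (h : u ≠ v) :
    ((3 : ℕ) : ℕ∞) < G.edist u v ↔ ¬ G.Adj u v ∧
      ∀ w, G.Adj u w → ¬ G.Adj w v ∧ ∀ x, G.Adj w x → ¬ G.Adj x v := by
  rw [natCast_lt_edist_iff]
  constructor
  · intro H
    refine ⟨fun h1 => ?_, fun w h1 => ⟨fun h2 => ?_, fun x h2 h3 => ?_⟩⟩
    · have := H (.cons h1 .nil)
      simp at this
    · have := H (.cons h1 (.cons h2 .nil))
      simp at this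
    · have := H (.cons h1 (.cons h2 (.cons h3 .nil)))
      simp at this
  · rintro ⟨H1, H2⟩ p
    match p with
    | .nil => exact absurd rfl h
    | .cons h1 .nil => exact absurd h1 H1
    | .cons h1 (.cons h2 .nil) => exact absurd h2 (H2 _ h1).1
    | .cons h1 (.cons h2 (.cons h3 .nil)) => exact absurd h3 ((H2 _ h1).2 _ h2)
    | .cons _ (.cons _ (.cons _ (.cons _ q))) =>
      simp only [SimpleGraph.Walk.length_cons]
      omega

theorem walk_length_ge_of_lipschitz {f : V → ℕ} (hf : ∀ u v, G.Adj u v → f v ≤ f u + 1)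
    {u v : V} (p : G.Walk u v) : f v ≤ f u + p.length := by
  induction p with
  | nil => simp
  | cons h p ih =>
    have := hf _ _ h
    simp only [SimpleGraph.Walk.length_cons]
    omega

end Distance

/-! ### From packing chromatic numbers to `(1, 3, 3)`-colorings -/

section Coloring

variable {V W : Type*} {G : SimpleGraph V} {H : SimpleGraph W} {s : ℕ → ℕ}

theorem isSPackingColoring_three_iff (hs1 : s 0 = 1) (hs2 : s 1 = 3) (hs3 : s 2 = 3)
    {c : V → Fin 3} : IsSPackingColoring s G 3 c ↔ IsPacking133 G c := by
  unfold IsSPackingColoring IsPacking133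
  refine forall_congr' fun u => forall_congr' fun v => forall_congr' fun huv =>
    forall_congr' fun _ => ?_
  have : c u = 0 ∨ c u = 1 ∨ c u = 2 := by
    generalize c u = a
    revert a
    decide
  rcases this with h | h | h
  · simp only [h, Fin.val_zero, hs1, one_lt_edist_iff huv]
    simp
  · rw [h, show ((1 : Fin 3) : ℕ) = 1 from rfl, hs2, three_lt_edist_iff huv]
    simp
  · rw [h, show ((2 : Fin 3) : ℕ) = 2 from rfl, hs3, three_lt_edist_iff huv]
    simp

theorem IsSPackingColoring.castLE {k l : ℕ} (hkl : k ≤ l) {c : V → Fin k}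
    (hc : IsSPackingColoring s G k c) : IsSPackingColoring s G l (fun v => (c v).castLE hkl) := by
  intro u v huv h
  simpa using hc u v huv (Fin.castLE_injective hkl h)

theorem sPackingChromaticNumber_le_iff {k : ℕ} :
    sPackingChromaticNumber s G ≤ k ↔ ∃ c : V → Fin k, IsSPackingColoring s G k c := by
  constructor
  · intro h
    have h' : sPackingChromaticNumber s G < ((k + 1 : ℕ) : ℕ∞) :=
      lt_of_le_of_lt h (by exact_mod_cast Nat.lt_succ_self k)
    unfold sPackingChromaticNumber at h'
    rw [iInf_lt_iff] at h'
    obtain ⟨l, hl⟩ := h'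
    rw [iInf_lt_iff] at hl
    obtain ⟨⟨c, hc⟩, hl⟩ := hl
    have hl' : l ≤ k := by
      have : l < k + 1 := by exact_mod_cast hl
      omega
    exact ⟨_, hc.castLE hl'⟩
  · rintro ⟨c, hc⟩
    exact iInf₂_le k ⟨c, hc⟩

theorem sPackingChromaticNumber_lt_four_iff (hs1 : s 0 = 1) (hs2 : s 1 = 3) (hs3 : s 2 = 3) :
    sPackingChromaticNumber s G < 4 ↔ Packable G := by
  have : sPackingChromaticNumber s G < 4 ↔ sPackingChromaticNumber s G ≤ (3 : ℕ) := by
    rw [show (4 : ℕ∞) = ((3 : ℕ) : ℕ∞) + 1 by norm_num]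
    exact Order.lt_add_one_iff_of_not_isMax (by simp)
  rw [this, sPackingChromaticNumber_le_iff]
  simp only [isSPackingColoring_three_iff hs1 hs2 hs3]
  rfl

/-- Separates the part that depends only on `s 0`, `s 1`, `s 2` from the existence of a
four-coloring, the only place where `s 3` can matter. -/
theorem isKSVertexCritical_four_iff (hs1 : s 0 = 1) (hs2 : s 1 = 3) (hs3 : s 2 = 3) :
    IsKSVertexCritical s 4 G ↔ ¬ Packable G ∧ (∀ u, Packable (G.induce {u}ᶜ)) ∧
      ∃ c : V → Fin 4, IsSPackingColoring s G 4 c := by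
  unfold IsKSVertexCritical IsSVertexCritical
  simp only [← sPackingChromaticNumber_lt_four_iff (G := G) hs1 hs2 hs3,
    ← sPackingChromaticNumber_le_iff]
  constructor
  · rintro ⟨h1, h2⟩
    rw [h2] at h1
    rw [h2]
    exact ⟨lt_irrefl _, fun u => (sPackingChromaticNumber_lt_four_iff hs1 hs2 hs3).1 (h1 u),
      le_rfl⟩
  · rintro ⟨h1, h2, h3⟩
    have h4 : sPackingChromaticNumber s G = (4 : ℕ) := le_antisymm h3 (not_lt.1 h1)
    refine ⟨fun u => ?_, h4⟩
    rw [h4]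
    exact (sPackingChromaticNumber_lt_four_iff hs1 hs2 hs3).2 (h2 u)

/-- A short walk in the subgraph maps to a walk of the same length, so distances can only shrink and
the coloring pulls back. -/
theorem Packable.of_injective (hG : Packable G) (φ : W → V) (hφ : Function.Injective φ)
    (hadj : ∀ a b, H.Adj a b → G.Adj (φ a) (φ b)) : Packable H := by
  obtain ⟨c, hc⟩ := hG
  refine ⟨c ∘ φ, fun u v huv h => ?_⟩
  obtain ⟨h1, h2⟩ := hc (φ u) (φ v) (hφ.ne huv) h
  exact ⟨fun h => h1 (hadj _ _ h), fun h0 w hw =>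
    ⟨fun h => (h2 h0 _ (hadj _ _ hw)).1 (hadj _ _ h),
      fun x hx h => (h2 h0 _ (hadj _ _ hw)).2 _ (hadj _ _ hx) (hadj _ _ h)⟩⟩

theorem isKSVertexCritical_four_of_iso (hs1 : s 0 = 1) (hs2 : s 1 = 3) (hs3 : s 2 = 3)
    (e : G ≃g H) (h : IsKSVertexCritical s 4 H) : IsKSVertexCritical s 4 G := by
  rw [isKSVertexCritical_four_iff hs1 hs2 hs3] at h ⊢
  obtain ⟨h1, h2, c, hc⟩ := h
  refine ⟨fun hG => h1 (hG.of_injective e.symm e.symm.injective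
    fun a b hab => e.symm.map_adj_iff.2 hab), fun u => ?_, c ∘ e, fun u v huv h => ?_⟩
  · refine (h2 (e u)).of_injective (fun v => ⟨e v.1, ?_⟩) ?_ ?_
    · exact fun h => v.2 (e.injective h)
    · intro v w hvw
      exact Subtype.ext (e.injective (by simpa using hvw))
    · intro a b hab
      exact e.map_adj_iff.2 hab
  · have := hc (e u) (e v) (e.injective.ne huv) h
    refine (natCast_lt_edist_iff.2 fun p => ?_)
    have h3 := natCast_lt_edist_iff.1 this (p.map e.toHom)
    rwa [SimpleGraph.Walk.length_map] at h3

/-- A `(1, 3, 3)`-packing coloring of `G` outside a single vertex gives an `S`-packing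
`4`-coloring. -/
theorem exists_four_coloring (hs1 : s 0 = 1) (hs2 : s 1 = 3) (hs3 : s 2 = 3) (u₀ : V)
    (c : V → Fin 3)
    (hc : ∀ u v, u ≠ u₀ → v ≠ u₀ → u ≠ v → c u = c v → ¬ G.Adj u v ∧
      (c u ≠ 0 → ∀ w, G.Adj u w → ¬ G.Adj w v ∧ ∀ x, G.Adj w x → ¬ G.Adj x v)) :
    ∃ c : V → Fin 4, IsSPackingColoring s G 4 c := by
  classical
  refine ⟨fun v => if v = u₀ then 3 else (c v).castSucc, fun u v huv h => ?_⟩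
  have h3 : ∀ a : Fin 3, (3 : Fin 4) ≠ a.castSucc := by decide
  by_cases hu : u = u₀
  · by_cases hv : v = u₀
    · exact absurd (hu.trans hv.symm) huv
    · simp [hu, hv, h3] at h
  · by_cases hv : v = u₀
    · simp [hu, hv, (h3 _).symm] at h
    · simp only [hu, hv, if_false] at h ⊢
      obtain ⟨H1, H2⟩ := hc u v hu hv huv (Fin.castSucc_injective _ h)
      have : c u = 0 ∨ c u = 1 ∨ c u = 2 := by
        generalize c u = a
        revert a
        decide
      rw [Fin.val_castSucc]
      rcases this with h | h | h
      · rw [h, Fin.val_zero, hs1]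
        exact (one_lt_edist_iff huv).2 H1
      · rw [h, show ((1 : Fin 3) : ℕ) = 1 from rfl, hs2, three_lt_edist_iff huv]
        exact ⟨H1, H2 (by rw [h]; decide)⟩
      · rw [h, show ((2 : Fin 3) : ℕ) = 2 from rfl, hs3, three_lt_edist_iff huv]
        exact ⟨H1, H2 (by rw [h]; decide)⟩

theorem packable_induce_compl (u₀ : V) (c : V → Fin 3)
    (hc : ∀ u v, u ≠ u₀ → v ≠ u₀ → u ≠ v → c u = c v → ¬ G.Adj u v ∧
      (c u ≠ 0 → ∀ w, G.Adj u w → w ≠ u₀ → ¬ G.Adj w v ∧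
        ∀ x, G.Adj w x → x ≠ u₀ → ¬ G.Adj x v)) :
    Packable (G.induce {u₀}ᶜ) := by
  refine ⟨fun v => c v, fun u v huv h => ?_⟩
  obtain ⟨h1, h2⟩ := hc u v u.2 v.2 (fun h => huv (Subtype.ext h)) h
  exact ⟨h1, fun h0 w hw => ⟨(h2 h0 w hw w.2).1, fun x hx => (h2 h0 w hw w.2).2 x hx x.2⟩⟩

/-- Coloring by levels: color `0` on odd levels, the level modulo four on even levels. -/
theorem packable_of_level (f : V → ℕ) (hf : ∀ u v, G.Adj u v → f u = f v + 1 ∨ f v = f u + 1)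
    (heven : ∀ u v w, u ≠ v → f u = f v → f u % 2 = 0 → G.Adj u w → ¬ G.Adj w v) :
    Packable G := by
  refine ⟨fun v => if f v % 4 = 0 then 1 else if f v % 4 = 2 then 2 else 0, fun u v huv h => ?_⟩
  have h' : (f u % 2 = 1 ∧ f v % 2 = 1) ∨ (f u % 2 = 0 ∧ f u % 4 = f v % 4) := by
    dsimp only at h
    split_ifs at h <;> omega
  -- Levels change parity along edges. Two even-level vertices are therefore never joined by a walk
  -- of length one or three. Along a walk of length two the levels differ by at most two, so being
  -- congruent modulo four they are equal, which is the case handled by `heven`.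
  refine ⟨fun hadj => ?_, fun h0 w hw => ⟨fun hwv => ?_, fun x hx hxv => ?_⟩⟩
  · have := hf _ _ hadj
    omega
  · have h2 : f u % 2 = 0 := by
      by_contra h2
      apply h0
      dsimp only
      rw [if_neg (by omega), if_neg (by omega)]
    have := hf _ _ hw
    have := hf _ _ hwv
    exact heven u v w huv (by omega) h2 hw hwv
  · have := hf _ _ hw
    have := hf _ _ hx
    have := hf _ _ hxv
    omega

/-- Two vertices covering all edges give a packing coloring. -/
theorem packable_of_cover (x y : V)
    (h : ∀ u v, G.Adj u v → u = x ∨ u = y ∨ v = x ∨ v = y) : Packable G := by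
  classical
  -- Colors `1` and `2` are used at most once, so no distance condition arises, and the remaining
  -- vertices are independent.
  refine ⟨fun v => if v = x then 1 else if v = y then 2 else 0, fun u v huv hc => ?_⟩
  have h1 : u ≠ x ∧ u ≠ y ∧ v ≠ x ∧ v ≠ y := by
    dsimp only at hc
    split_ifs at hc <;> simp_all
  refine ⟨fun hadj => ?_, fun h0 => ?_⟩
  · have := h u v hadj
    tauto
  · simp [h1] at h0

end Coloring

/-! ### Local constraints on a packing coloring -/

namespace IsPacking133

variable {V : Type*} {G : SimpleGraph V} {c : V → Fin 3}

theorem ne (hc : IsPacking133 G c) {u v : V} (h : G.Adj u v) : c u ≠ c v :=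
  fun h' => (hc u v h.ne h').1 h

theorem two (hc : IsPacking133 G c) {u w v : V} (h1 : G.Adj u w) (h2 : G.Adj w v) (huv : u ≠ v)
    (h : c u = c v) : c u = 0 := by
  by_contra h0
  exact ((hc u v huv h).2 h0 w h1).1 h2

theorem three (hc : IsPacking133 G c) {u w x v : V} (h1 : G.Adj u w) (h2 : G.Adj w x)
    (h3 : G.Adj x v) (huv : u ≠ v) (h : c u = c v) : c u = 0 := by
  by_contra h0
  exact ((hc u v huv h).2 h0 w h1).2 x h2 h3

/-- A vertex with three neighbors does not have color `0`. -/
theorem ne_zero (hc : IsPacking133 G c) {u a b d : V} (ha : G.Adj u a) (hb : G.Adj u b)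
    (hd : G.Adj u d) (hab : a ≠ b) (had : a ≠ d) (hbd : b ≠ d) : c u ≠ 0 := by
  have h1 := hc.ne ha
  have h2 := hc.ne hb
  have h3 := hc.ne hd
  -- The three neighbors are pairwise within distance two and so cannot share a nonzero color. If
  -- `u` had color `0` they would need three nonzero colors.
  have h4 := hc.two ha.symm hb hab
  have h5 := hc.two ha.symm hd had
  have h6 := hc.two hb.symm hd hbd
  generalize c u = x at *
  generalize c a = y at *
  generalize c b = z at *
  generalize c d = w at *
  omega

end IsPacking133

/-! ### Noncolorability of forked paths -/

section Path

variable {V : Type*} {G : SimpleGraph V}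

/-- A path of even order at least six with a further neighbor at each of its two support vertices
has no packing coloring. -/
theorem not_packable_of_forked_path {k : ℕ} (hk : 3 ≤ k) (p : ℕ → V) (a b : V)
    (hinj : ∀ i j, i < j → j < 2 * k → p i ≠ p j)
    (hadj : ∀ i, i + 1 < 2 * k → G.Adj (p i) (p (i + 1)))
    (ha : G.Adj (p 1) a) (ha0 : a ≠ p 0) (ha2 : a ≠ p 2)
    (hb : G.Adj (p (2 * k - 2)) b) (hb0 : b ≠ p (2 * k - 3)) (hb2 : b ≠ p (2 * k - 1)) :
    ¬ Packable G := by
  rintro ⟨c, hc⟩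
  have h1 : c (p 1) ≠ 0 := hc.ne_zero (hadj 0 (by omega)).symm (hadj 1 (by omega)) ha
    (hinj _ _ (by omega) (by omega)) ha0.symm ha2.symm
  have hlast : c (p (2 * k - 2)) ≠ 0 := by
    have e1 := hadj (2 * k - 3) (by omega)
    have e2 := hadj (2 * k - 2) (by omega)
    rw [show 2 * k - 3 + 1 = 2 * k - 2 by omega] at e1
    rw [show 2 * k - 2 + 1 = 2 * k - 1 by omega] at e2
    exact hc.ne_zero e1.symm e2 hb (hinj _ _ (by omega) (by omega)) hb0.symm hb2.symm
  -- The pattern zero on even positions and nonzero on odd ones propagates from `p 1` and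
  -- contradicts `hlast`. If `p 1` and `p 2` were both nonzero, `p 3` would be `0` and `p 4` would
  -- have no color. Later, positions `2 * j + 1` and `2 * j + 3` carry both nonzero colors, and both
  -- are within distance three of position `2 * j + 4`.
  have key : ∀ j, 2 * j + 2 ≤ 2 * k - 2 → c (p (2 * j + 2)) = 0 ∧ c (p (2 * j + 1)) ≠ 0 := by
    intro j
    induction j with
    | zero =>
      intro _
      refine ⟨?_, h1⟩
      have a1 := hadj 1 (by omega)
      have a2 := hadj 2 (by omega)
      have a3 := hadj 3 (by omega)
      have b1 := hc.ne a1
      have b2 := hc.ne a2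
      have b3 := hc.ne a3
      have b4 := hc.two a1 a2 (hinj _ _ (by omega) (by omega))
      have b5 := hc.two a2 a3 (hinj _ _ (by omega) (by omega))
      have b6 := hc.three a1 a2 a3 (hinj _ _ (by omega) (by omega))
      simp only [Nat.reduceAdd, Nat.reduceMul] at *
      omega
    | succ j ih =>
      intro hj
      obtain ⟨h2, h3⟩ := ih (by omega)
      have a1 := hadj (2 * j + 1) (by omega)
      have a2 := hadj (2 * j + 2) (by omega)
      have a3 := hadj (2 * j + 3) (by omega)
      have b2 := hc.ne a2
      have b3 := hc.ne a3
      have b4 := hc.two a1 a2 (hinj _ _ (by omega) (by omega))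
      have b6 := hc.three a1 a2 a3 (hinj _ _ (by omega) (by omega))
      rw [show 2 * (j + 1) + 2 = 2 * j + 3 + 1 by ring, show 2 * (j + 1) + 1 = 2 * j + 2 + 1 by ring]
      simp only [Nat.add_assoc, Nat.reduceAdd] at *
      omega
  refine hlast ?_
  have := (key (k - 2) (by omega)).1
  rwa [show 2 * (k - 2) + 2 = 2 * k - 2 by omega] at this

end Path

/-! ### Criticality of the graphs `graphG k` -/

section ForkedPath

variable {k : ℕ}

theorem graphG_adj_inl_inl {i j : Fin (2 * k)} :
    (graphG k).Adj (Sum.inl i) (Sum.inl j) ↔ i.val + 1 = j.val ∨ j.val + 1 = i.val := by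
  simp only [graphG, SimpleGraph.fromRel_adj, ne_eq, Sum.inl.injEq, Fin.ext_iff]
  omega

theorem graphG_adj_inl_false {i : Fin (2 * k)} :
    (graphG k).Adj (Sum.inl i) (Sum.inr false) ↔ i.val = 1 := by
  simp [graphG, SimpleGraph.fromRel_adj]

theorem graphG_adj_inl_true {i : Fin (2 * k)} :
    (graphG k).Adj (Sum.inl i) (Sum.inr true) ↔ i.val + 2 = 2 * k := by
  have := i.2
  simp only [graphG, SimpleGraph.fromRel_adj, ne_eq, reduceCtorEq, not_false_eq_true, or_false,
    true_and]
  omega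

theorem not_graphG_adj_inr_inr {x y : Bool} : ¬ (graphG k).Adj (Sum.inr x) (Sum.inr y) := by
  simp [graphG, SimpleGraph.fromRel_adj]

/-- The position of a vertex of `G_{2k}` along the path, where each pendant vertex has the
position of its twin. -/
def graphGLevel (k : ℕ) : Fin (2 * k) ⊕ Bool → ℕ
  | Sum.inl i => i.val
  | Sum.inr false => 0
  | Sum.inr true => 2 * k - 1

theorem graphGLevel_of_adj (hk : 3 ≤ k) {x y : Fin (2 * k) ⊕ Bool} (h : (graphG k).Adj x y) :
    graphGLevel k x = graphGLevel k y + 1 ∨ graphGLevel k y = graphGLevel k x + 1 := by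
  rcases x with i | (_ | _) <;> rcases y with j | (_ | _)
  · rw [graphG_adj_inl_inl] at h
    simp only [graphGLevel]
    omega
  · rw [graphG_adj_inl_false] at h
    simp only [graphGLevel]
    omega
  · rw [graphG_adj_inl_true] at h
    simp only [graphGLevel]
    omega
  · rw [SimpleGraph.adj_comm, graphG_adj_inl_false] at h
    simp only [graphGLevel]
    omega
  · exact absurd h not_graphG_adj_inr_inr
  · exact absurd h not_graphG_adj_inr_inr
  · rw [SimpleGraph.adj_comm, graphG_adj_inl_true] at h
    simp only [graphGLevel]
    omega
  · exact absurd h not_graphG_adj_inr_inr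
  · exact absurd h not_graphG_adj_inr_inr

theorem graphGLevel_le (hk : 3 ≤ k) (x : Fin (2 * k) ⊕ Bool) : graphGLevel k x ≤ 2 * k - 1 := by
  rcases x with i | (_ | _) <;> simp only [graphGLevel] <;> omega

theorem eq_or_of_graphGLevel_eq (hk : 3 ≤ k) {x y : Fin (2 * k) ⊕ Bool}
    (h : graphGLevel k x = graphGLevel k y) :
    x = y ∨ graphGLevel k x = 0 ∨ graphGLevel k x = 2 * k - 1 := by
  rcases x with i | (_ | _) <;> rcases y with j | (_ | _) <;> simp only [graphGLevel] at * <;>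
    simp [Fin.ext_iff] <;> omega

theorem eq_or_eq_of_graphGLevel_eq (hk : 3 ≤ k) {x y z : Fin (2 * k) ⊕ Bool}
    (h : graphGLevel k x = graphGLevel k y) (h' : graphGLevel k x = graphGLevel k z) :
    x = y ∨ x = z ∨ y = z := by
  rcases x with i | (_ | _) <;> rcases y with j | (_ | _) <;> rcases z with l | (_ | _) <;>
    simp only [graphGLevel] at * <;> simp [Fin.ext_iff] <;> omega

theorem not_packable_graphG (hk : 3 ≤ k) : ¬ Packable (graphG k) := by
  have hpos : 0 < 2 * k := by omega
  refine not_packable_of_forked_path hk (fun i => Sum.inl ⟨i % (2 * k), Nat.mod_lt _ hpos⟩)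
    (Sum.inr false) (Sum.inr true) ?_ ?_ ?_ (by simp) (by simp) ?_ (by simp) (by simp)
  · intro i j hij hj
    simp only [ne_eq, Sum.inl.injEq, Fin.mk.injEq]
    rw [Nat.mod_eq_of_lt hj, Nat.mod_eq_of_lt (hij.trans hj)]
    omega
  · intro i hi
    rw [graphG_adj_inl_inl]
    simp only
    rw [Nat.mod_eq_of_lt hi, Nat.mod_eq_of_lt (by omega)]
    omega
  · rw [graphG_adj_inl_false]
    simp only
    rw [Nat.mod_eq_of_lt (by omega)]
  · rw [graphG_adj_inl_true]
    simp only
    rw [Nat.mod_eq_of_lt (by omega)]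
    omega

theorem packable_graphG_induce_compl (hk : 3 ≤ k) (u : Fin (2 * k) ⊕ Bool) :
    Packable ((graphG k).induce {u}ᶜ) := by
  -- Both pairs of twins must lie on odd levels: those at `0` need a shift by one, those at `2 * k -
  -- 1` do not. Deleting an inner `u` disconnects the graph, so only the left side is shifted. If
  -- `u` is an end vertex its twin is left single and one global choice of shift suffices.
  refine packable_of_level (fun x => if graphGLevel k x < graphGLevel k u ∨
    graphGLevel k u = 2 * k - 1 then graphGLevel k x + 1 else graphGLevel k x) ?_ ?_
  · rintro ⟨x, hx⟩ ⟨y, hy⟩ h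
    have h1 := graphGLevel_of_adj hk (show (graphG k).Adj x y from h)
    have h2 := fun h => eq_or_of_graphGLevel_eq hk (x := x) (y := u) h
    have h3 := fun h => eq_or_of_graphGLevel_eq hk (x := y) (y := u) h
    simp only [Set.mem_compl_iff, Set.mem_singleton_iff] at hx hy
    simp only [hx, hy, false_or] at h2 h3
    dsimp only
    split_ifs <;> omega
  · rintro ⟨x, hx⟩ ⟨y, hy⟩ ⟨w, hw⟩ hxy h h' - -
    have h2 := fun h => eq_or_of_graphGLevel_eq hk (x := x) (y := u) h
    have h3 := fun h => eq_or_of_graphGLevel_eq hk (x := y) (y := u) h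
    have h4 := fun h => eq_or_of_graphGLevel_eq hk (x := x) (y := y) h
    have h5 := fun h h' => eq_or_eq_of_graphGLevel_eq hk (x := x) (y := y) (z := u) h h'
    simp only [Set.mem_compl_iff, Set.mem_singleton_iff] at hx hy
    have hxy' : x ≠ y := fun h => hxy (Subtype.ext h)
    have h6 := graphGLevel_le hk x
    have h7 := graphGLevel_le hk u
    simp only [hx, hy, hxy', false_or, or_false, imp_false] at h2 h3 h4 h5
    dsimp only at h h'
    split_ifs at h h' <;> omega

theorem exists_four_coloring_graphG {s : ℕ → ℕ} (hs1 : s 0 = 1) (hs2 : s 1 = 3) (hs3 : s 2 = 3)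
    (hk : 3 ≤ k) : ∃ c : Fin (2 * k) ⊕ Bool → Fin 4, IsSPackingColoring s (graphG k) 4 c := by
  -- The right support vertex takes the fourth color. Its two leaves then get color `0`, and the
  -- rest is colored by level, with `0` on the even levels.
  obtain ⟨u, hu⟩ : ∃ u, graphGLevel k u = 2 * k - 2 := ⟨Sum.inl ⟨2 * k - 2, by omega⟩, rfl⟩
  refine exists_four_coloring hs1 hs2 hs3 u
    (fun x => if graphGLevel k x % 2 = 0 ∨ graphGLevel k x = 2 * k - 1 then 0 else
      if graphGLevel k x % 4 = 1 then 1 else 2) ?_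
  intro x y hx hy hxy h
  have h2 := fun h => eq_or_of_graphGLevel_eq hk (x := x) (y := u) h
  have h3 := fun h => eq_or_of_graphGLevel_eq hk (x := y) (y := u) h
  have h4 := fun h => eq_or_of_graphGLevel_eq hk (x := x) (y := y) h
  simp only [hx, hy, hxy, false_or] at h2 h3 h4
  refine ⟨fun hadj => ?_, fun h0 => ?_⟩
  · have := graphGLevel_of_adj hk hadj
    have := graphGLevel_le hk x
    have := graphGLevel_le hk y
    split_ifs at h <;> omega
  · have h5 : ¬ (graphGLevel k x % 2 = 0 ∨ graphGLevel k x = 2 * k - 1) := by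
      intro h5
      exact h0 (if_pos h5)
    have h6 : graphGLevel k x % 4 = graphGLevel k y % 4 := by
      split_ifs at h <;> omega
    refine fun w hw => ⟨fun hwv => ?_, fun z hz hzy => ?_⟩
    · have := graphGLevel_of_adj hk hw
      have := graphGLevel_of_adj hk hwv
      omega
    · have := graphGLevel_of_adj hk hw
      have := graphGLevel_of_adj hk hz
      have := graphGLevel_of_adj hk hzy
      omega

theorem isKSVertexCritical_graphG {s : ℕ → ℕ} (hs1 : s 0 = 1) (hs2 : s 1 = 3) (hs3 : s 2 = 3)
    (hk : 3 ≤ k) : IsKSVertexCritical s 4 (graphG k) :=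
  (isKSVertexCritical_four_iff hs1 hs2 hs3).2 ⟨not_packable_graphG hk,
    packable_graphG_induce_compl hk, exists_four_coloring_graphG hs1 hs2 hs3 hk⟩

end ForkedPath

/-! ### Cycles -/

section Cycle

variable {n : ℕ}

theorem cycleGraph_adj_iff_val (hn : 3 ≤ n) {u v : Fin n} :
    (SimpleGraph.cycleGraph n).Adj u v ↔ u.val + 1 = v.val ∨ v.val + 1 = u.val ∨
      (u.val = 0 ∧ v.val + 1 = n) ∨ (v.val = 0 ∧ u.val + 1 = n) := by
  have key : ∀ a b : Fin n, (a - b).val = 1 ↔ b.val + 1 = a.val ∨ (a.val = 0 ∧ b.val + 1 = n) := by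
    intro a b
    have ha := a.2
    have hb := b.2
    rw [Fin.val_sub]
    by_cases h : b.val ≤ a.val
    · rw [show n - b.val + a.val = n + (a.val - b.val) by omega, Nat.add_mod_left,
        Nat.mod_eq_of_lt (by omega)]
      omega
    · rw [Nat.mod_eq_of_lt (by omega)]
      omega
  rw [SimpleGraph.cycleGraph_adj', key, key]
  omega

/-- The vertex of the cycle of order `n` in position `i` modulo `n`. -/
def cyclePoint (hn : 0 < n) (i : ℕ) : Fin n := ⟨i % n, Nat.mod_lt i hn⟩

theorem cyclePoint_val (hn : 0 < n) (u : Fin n) : cyclePoint hn u.val = u :=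
  Fin.ext (Nat.mod_eq_of_lt u.2)

theorem cyclePoint_adj (hn : 3 ≤ n) (i : ℕ) :
    (SimpleGraph.cycleGraph n).Adj (cyclePoint (by omega) i) (cyclePoint (by omega) (i + 1)) := by
  rw [cycleGraph_adj_iff_val hn]
  simp only [cyclePoint]
  have := Nat.mod_lt i (show n > 0 by omega)
  rw [Nat.add_mod, Nat.mod_eq_of_lt (show 1 < n by omega)]
  by_cases h : i % n + 1 = n
  · rw [h, Nat.mod_self]
    omega
  · rw [Nat.mod_eq_of_lt (show i % n + 1 < n by omega)]
    omega

theorem cyclePoint_add_ne (hn : 0 < n) (i : ℕ) {t : ℕ} (ht : 0 < t) (htn : t < n) :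
    cyclePoint hn i ≠ cyclePoint hn (i + t) := by
  intro h
  have h1 : i + 0 ≡ i + t [MOD n] := Fin.ext_iff.1 h
  have h2 := Nat.ModEq.add_left_cancel' i h1
  unfold Nat.ModEq at h2
  rw [Nat.mod_eq_of_lt htn, Nat.zero_mod] at h2
  omega

theorem exists_walk_cyclePoint (hn : 3 ≤ n) (i t : ℕ) :
    ∃ p : (SimpleGraph.cycleGraph n).Walk (cyclePoint (by omega) i)
      (cyclePoint (by omega) (i + t)), p.length = t := by
  induction t with
  | zero => exact ⟨.nil, rfl⟩
  | succ t ih =>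
    obtain ⟨p, hp⟩ := ih
    exact ⟨p.concat (cyclePoint_adj hn (i + t)), by simp [hp]⟩

/-- A set of vertices of a cycle with gaps at least `m` has density at most `1 / m`. -/
theorem mul_card_le_of_gaps {m : ℕ} (S : Finset (Fin n))
    (h : ∀ u ∈ S, ∀ v ∈ S, ∀ t, 0 < t → t < m → (v.val + t) % n ≠ u.val) : m * S.card ≤ n := by
  rcases Nat.eq_zero_or_pos n with rfl | hn
  · simp [Finset.eq_empty_of_isEmpty S]
  have key : ∀ u ∈ S, ∀ v ∈ S, ∀ i j, i ≤ j → j < m → (u.val + i) % n = (v.val + j) % n →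
      i = j ∧ u = v := by
    intro u hu v hv i j hij hj hmod
    obtain ⟨t, rfl⟩ := Nat.exists_eq_add_of_le hij
    have h1 : u.val + i ≡ (v.val + t) + i [MOD n] := by
      rw [show v.val + t + i = v.val + (i + t) by ring]
      exact hmod
    have h2 : u.val % n = (v.val + t) % n := Nat.ModEq.add_right_cancel' i h1
    rw [Nat.mod_eq_of_lt u.2] at h2
    rcases Nat.eq_zero_or_pos t with rfl | ht
    · rw [Nat.add_zero, Nat.mod_eq_of_lt v.2] at h2
      exact ⟨rfl, Fin.ext h2⟩
    · exact absurd h2.symm (h u hu v hv t ht (by omega))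
  -- The translates of `S` by `0, …, m - 1` are pairwise disjoint, by `key`.
  have := Finset.card_le_card_of_injOn (s := Finset.range m ×ˢ S) (t := Finset.range n)
    (fun x => (x.2.val + x.1) % n) (fun x _ => by simpa using Nat.mod_lt _ hn) (by
      rintro ⟨i, u⟩ hx ⟨j, v⟩ hy hxy
      simp only [Finset.coe_product, Finset.coe_range, Set.mem_prod, Set.mem_Iio,
        Finset.mem_coe] at hx hy hxy
      rcases le_total i j with hij | hij
      · obtain ⟨rfl, rfl⟩ := key u hx.2 v hy.2 i j hij hy.1 hxy
        rfl
      · obtain ⟨rfl, rfl⟩ := key v hy.2 u hx.2 j i hij hx.1 hxy.symm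
        rfl)
  simpa using this

/-- Walking `t` steps around the cycle joins positions `v` and `v + t`, so a color class has no gap
of `s i` or less and the density bound applies. -/
theorem mul_card_color_le {s : ℕ → ℕ} {k : ℕ} (hn : 3 ≤ n) {c : Fin n → Fin k}
    (hc : IsSPackingColoring s (SimpleGraph.cycleGraph n) k c) (i : Fin k) {m : ℕ}
    (hm : m ≤ s i + 1) (hmn : m ≤ n) : m * (Finset.univ.filter fun v => c v = i).card ≤ n := by
  refine mul_card_le_of_gaps _ fun u hu v hv t ht htm h => ?_
  rw [Finset.mem_filter] at hu hv
  have e : cyclePoint (by omega) (v.val + t) = u := Fin.ext h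
  have huv : v ≠ u := by
    have h0 : 0 < n := by omega
    have := cyclePoint_add_ne h0 v.val ht (by omega)
    rwa [cyclePoint_val, e] at this
  have h1 := natCast_lt_edist_iff.1 (hc v u huv (hv.2.trans hu.2.symm))
  obtain ⟨p, hp⟩ := exists_walk_cyclePoint hn v.val t
  have := h1 (p.copy (cyclePoint_val (by omega) v) e)
  rw [SimpleGraph.Walk.length_copy, hp, hv.2] at this
  omega

/-- The classes hold at most `n / 2`, `n / 4` and `n / 4` vertices, rounded down. The sum reaches
`n` only when `4` divides `n`. -/
theorem not_packable_cycleGraph (hn : 5 ≤ n) (hn4 : n % 4 ≠ 0) :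
    ¬ Packable (SimpleGraph.cycleGraph n) := by
  rintro ⟨c, hc⟩
  rw [← isSPackingColoring_three_iff (s := fun i => if i = 0 then 1 else 3) rfl rfl rfl] at hc
  have h0 := mul_card_color_le (by omega) hc 0 (m := 2) (by simp) (by omega)
  have h1 := mul_card_color_le (by omega) hc 1 (m := 4) (by simp) (by omega)
  have h2 := mul_card_color_le (by omega) hc 2 (m := 4) (by simp) (by omega)
  have h3 := Finset.card_eq_sum_card_fiberwise (s := (Finset.univ : Finset (Fin n)))
    (t := Finset.univ) (f := c) (by simp)
  rw [Fin.sum_univ_three, Finset.card_univ, Fintype.card_fin] at h3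
  omega

/-- For `n = 4 * q + 3` the first three classes hold at most `4 * q + 1` vertices, so two vertices
have the fourth color. Both arcs between them are longer than `s 3`, and the arcs have total length
`n`. -/
theorem lt_half_of_four_coloring {s : ℕ → ℕ} (hs1 : s 0 = 1) (hs2 : s 1 = 3) (hs3 : s 2 = 3)
    (hn : 5 ≤ n) (hn4 : n % 4 = 3) {c : Fin n → Fin 4}
    (hc : IsSPackingColoring s (SimpleGraph.cycleGraph n) 4 c) : s 3 < n / 2 := by
  have h0 := mul_card_color_le (by omega) hc 0 (m := 2) (by simp [hs1]) (by omega)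
  have h1 := mul_card_color_le (by omega) hc 1 (m := 4) (by simp [hs2]) (by omega)
  have h2 := mul_card_color_le (by omega) hc 2 (m := 4) (by simp [hs3]) (by omega)
  have h3 := Finset.card_eq_sum_card_fiberwise (s := (Finset.univ : Finset (Fin n)))
    (t := Finset.univ) (f := c) (by simp)
  rw [Fin.sum_univ_four, Finset.card_univ, Fintype.card_fin] at h3
  have h4 : 1 < (Finset.univ.filter fun v => c v = 3).card := by omega
  obtain ⟨u, hu, v, hv, huv⟩ := Finset.one_lt_card.1 h4
  rw [Finset.mem_filter] at hu hv
  have key : ∀ u v : Fin n, u < v → c u = 3 → c v = 3 → s 3 < n / 2 := by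
    intro u v huv hu hv
    have hlt : u.val < v.val := huv
    have h5 := natCast_lt_edist_iff.1 (hc u v huv.ne (hu.trans hv.symm))
    have h6 := natCast_lt_edist_iff.1 (hc v u huv.ne' (hv.trans hu.symm))
    obtain ⟨p, hp⟩ := exists_walk_cyclePoint (n := n) (by omega) u.val (v.val - u.val)
    obtain ⟨q, hq⟩ := exists_walk_cyclePoint (n := n) (by omega) v.val (n - v.val + u.val)
    have hv' := v.2
    have e1 : cyclePoint (n := n) (by omega) (u.val + (v.val - u.val)) = v := by
      rw [show u.val + (v.val - u.val) = v.val by omega, cyclePoint_val]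
    have e2 : cyclePoint (n := n) (by omega) (v.val + (n - v.val + u.val)) = u := by
      refine Fin.ext ?_
      simp only [cyclePoint]
      rw [show v.val + (n - v.val + u.val) = n + u.val by omega, Nat.add_mod_left,
        Nat.mod_eq_of_lt u.2]
    have h7 := h5 (p.copy (cyclePoint_val (by omega) u) e1)
    have h8 := h6 (q.copy (cyclePoint_val (by omega) v) e2)
    rw [SimpleGraph.Walk.length_copy, hp, hu] at h7
    rw [SimpleGraph.Walk.length_copy, hq, hv] at h8
    simp only [show ((3 : Fin 4) : ℕ) = 3 from rfl] at h7 h8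
    omega
  rcases lt_or_gt_of_ne huv with h | h
  · exact key u v h hu.2 hv.2
  · exact key v u h hv.2 hu.2

theorem packable_cycleGraph_induce_compl (hn : 3 ≤ n) (u : Fin n) :
    Packable ((SimpleGraph.cycleGraph n).induce {u}ᶜ) := by
  -- The level is the number of steps from `u` in the positive direction. All levels are distinct,
  -- so `heven` holds trivially.
  refine packable_of_level (fun x => if u.val < x.1.val then x.1.val - u.val else
    x.1.val + n - u.val) ?_ ?_
  · rintro ⟨x, hx⟩ ⟨y, hy⟩ h
    have h1 := (cycleGraph_adj_iff_val hn).1 (show (SimpleGraph.cycleGraph n).Adj x y from h)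
    simp only [Set.mem_compl_iff, Set.mem_singleton_iff, Fin.ext_iff] at hx hy
    have hx' := x.2
    have hy' := y.2
    have hu' := u.2
    dsimp only
    split_ifs <;> omega
  · rintro ⟨x, hx⟩ ⟨y, hy⟩ ⟨w, hw⟩ hxy h - - -
    refine hxy (Subtype.ext (Fin.ext ?_))
    have hx' := x.2
    have hy' := y.2
    have hu' := u.2
    dsimp only at h ⊢
    split_ifs at h <;> omega

theorem exists_four_coloring_cycleGraph {s : ℕ → ℕ} (hs1 : s 0 = 1) (hs2 : s 1 = 3)
    (hs3 : s 2 = 3) (hn : 5 ≤ n) (hn4 : n % 4 = 1 ∨ n % 4 = 2) :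
    ∃ c : Fin n → Fin 4, IsSPackingColoring s (SimpleGraph.cycleGraph n) 4 c := by
  -- Vertex `0` takes the fourth color and the period-four pattern runs over the rest. Across vertex
  -- `0` the last even position is a multiple of four, so it differs in color from position `2`. For
  -- `n % 4 = 3` this clash would occur.
  refine exists_four_coloring hs1 hs2 hs3 ⟨0, by omega⟩
    (fun v => if v.val % 2 = 1 then 0 else if v.val % 4 = 2 then 1 else 2) ?_
  intro u v hu hv huv h
  simp only [ne_eq, Fin.ext_iff] at hu hv huv
  have hu' := u.2
  have hv' := v.2
  have h1 : (u.val % 2 = 1 ∧ v.val % 2 = 1) ∨ (u.val % 2 = 0 ∧ u.val % 4 = v.val % 4) := by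
    split_ifs at h <;> omega
  refine ⟨fun hadj => ?_, fun h0 => ?_⟩
  · rw [cycleGraph_adj_iff_val (by omega)] at hadj
    omega
  · have h2 : u.val % 2 = 0 := by
      by_contra h2
      exact h0 (if_pos (by omega))
    refine fun w hw => ⟨fun hwv => ?_, fun z hz hzy => ?_⟩
    · rw [cycleGraph_adj_iff_val (by omega)] at hw hwv
      omega
    · rw [cycleGraph_adj_iff_val (by omega)] at hw hz hzy
      omega

theorem exists_four_coloring_cycleGraph_of_lt {s : ℕ → ℕ} (hs1 : s 0 = 1) (hs2 : s 1 = 3)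
    (hs3 : s 2 = 3) (hn : 5 ≤ n) (hn4 : n % 4 = 3) (hs4 : s 3 < n / 2) :
    ∃ c : Fin n → Fin 4, IsSPackingColoring s (SimpleGraph.cycleGraph n) 4 c := by
  obtain ⟨m, rfl⟩ : ∃ m, n = 4 * m + 3 := ⟨n / 4, by omega⟩
  -- The fourth color sits on the almost antipodal vertices `0` and `2 * m + 1`, at distance `2 * m
  -- + 1 = n / 2`. The function `g` renumbers the others consecutively so that the period-four
  -- pattern skips over `2 * m + 1`.
  obtain ⟨g, hg⟩ : ∃ g : ℕ → ℕ, ∀ i, g i = if 2 * m + 1 < i then i - 1 else i := ⟨_, fun _ => rfl⟩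
  refine ⟨fun v => if v.val = 0 ∨ v.val = 2 * m + 1 then 3 else if g v.val % 2 = 1 then 0 else
    if g v.val % 4 = 2 then 1 else 2, fun u v huv h => ?_⟩
  simp only [ne_eq, Fin.ext_iff] at huv
  have hu' := u.2
  have hv' := v.2
  by_cases hu : u.val = 0 ∨ u.val = 2 * m + 1
  · by_cases hv : v.val = 0 ∨ v.val = 2 * m + 1
    · dsimp only at h ⊢
      rw [if_pos hu, show ((3 : Fin 4) : ℕ) = 3 from rfl, natCast_lt_edist_iff]
      -- This quantity is the distance to vertex `0`, and it changes by at most one along an edge.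
      have hlip : ∀ a b, (SimpleGraph.cycleGraph (4 * m + 3)).Adj a b →
          min b.val (4 * m + 3 - b.val) ≤ min a.val (4 * m + 3 - a.val) + 1 := by
        intro a b hab
        rw [cycleGraph_adj_iff_val (by omega)] at hab
        omega
      intro p
      have h1 := walk_length_ge_of_lipschitz hlip p
      have h2 := walk_length_ge_of_lipschitz hlip p.reverse
      rw [SimpleGraph.Walk.length_reverse] at h2
      omega
    · dsimp only at h
      rw [if_pos hu, if_neg hv] at h
      split_ifs at h <;> exact absurd h (by decide)
  · by_cases hv : v.val = 0 ∨ v.val = 2 * m + 1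
    · dsimp only at h
      rw [if_neg hu, if_pos hv] at h
      split_ifs at h <;> exact absurd h (by decide)
    · dsimp only at h ⊢
      rw [if_neg hu, if_neg hv] at h
      rw [if_neg hu]
      have hne : u ≠ v := fun h => huv (congrArg Fin.val h)
      have hgu := hg u.val
      have hgv := hg v.val
      by_cases h1 : g u.val % 2 = 1
      · have h2 : g v.val % 2 = 1 := by
          rw [if_pos h1] at h
          split_ifs at h with h2 h3
          · exact h2
          · exact absurd h (by decide)
          · exact absurd h (by decide)
        rw [if_pos h1, Fin.val_zero, hs1, one_lt_edist_iff hne]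
        intro hadj
        rw [cycleGraph_adj_iff_val (by omega)] at hadj
        split_ifs at hgu hgv <;> omega
      · have h2 : g v.val % 4 = g u.val % 4 := by
          rw [if_neg h1] at h
          split_ifs at h <;> omega
        have h3 : s ((if g u.val % 2 = 1 then 0 else if g u.val % 4 = 2 then 1 else 2 : Fin 4)) =
            3 := by
          rw [if_neg h1]
          split_ifs
          · exact hs2
          · exact hs3
        rw [h3, three_lt_edist_iff hne]
        have key : ∀ t, t ≤ 3 → 0 < t → ¬ (u.val + t = v.val ∨ v.val + t = u.val ∨
            u.val + t = v.val + (4 * m + 3) ∨ v.val + t = u.val + (4 * m + 3)) := by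
          intro t ht ht0 h
          split_ifs at hgu hgv <;> omega
        have step : ∀ {a b : Fin (4 * m + 3)}, (SimpleGraph.cycleGraph (4 * m + 3)).Adj a b →
            ((b.val : ℤ) - a.val = 1 ∨ (b.val : ℤ) - a.val = -1 ∨
              (b.val : ℤ) - a.val = 4 * m + 2 ∨ (b.val : ℤ) - a.val = - (4 * m + 2)) := by
          intro a b hab
          rw [cycleGraph_adj_iff_val (by omega)] at hab
          omega
        -- Signed displacements modulo the order: no walk of at most three steps produces the
        -- difference between `u` and `v`.
        have key' : ∀ t : ℤ, -3 ≤ t ∧ t ≤ 3 ∧ t ≠ 0 → ¬ ((v.val : ℤ) - u.val = t ∨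
            (v.val : ℤ) - u.val = t + (4 * m + 3) ∨ (v.val : ℤ) - u.val = t - (4 * m + 3)) := by
          intro t ht h
          have h1 := key t.natAbs (by omega) (by omega)
          omega
        have k1 := key' 1 (by decide)
        have k2 := key' 2 (by decide)
        have k3 := key' 3 (by decide)
        have l1 := key' (-1) (by decide)
        have l2 := key' (-2) (by decide)
        have l3 := key' (-3) (by decide)
        refine ⟨fun hadj => ?_, fun w hw => ⟨fun hwv => ?_, fun z hz hzy => ?_⟩⟩
        · have := step hadj
          omega
        · have := step hw
          have := step hwv
          omega
        · have := step hw
          have := step hz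
          have := step hzy
          omega

theorem isKSVertexCritical_cycleGraph {s : ℕ → ℕ} (hs1 : s 0 = 1) (hs2 : s 1 = 3) (hs3 : s 2 = 3)
    (hn : 5 ≤ n) (hn4 : n % 4 = 1 ∨ n % 4 = 2 ∨ (n % 4 = 3 ∧ s 3 < n / 2)) :
    IsKSVertexCritical s 4 (SimpleGraph.cycleGraph n) := by
  refine (isKSVertexCritical_four_iff hs1 hs2 hs3).2 ⟨not_packable_cycleGraph hn (by omega),
    packable_cycleGraph_induce_compl (by omega), ?_⟩
  rcases hn4 with h | h | ⟨h, h'⟩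
  · exact exists_four_coloring_cycleGraph hs1 hs2 hs3 hn (Or.inl h)
  · exact exists_four_coloring_cycleGraph hs1 hs2 hs3 hn (Or.inr h)
  · exact exists_four_coloring_cycleGraph_of_lt hs1 hs2 hs3 hn h h'

end Cycle

/-! ### Criticality of the sporadic graphs -/

section SmallGraphs

variable {V : Type*} {G : SimpleGraph V}

instance graphOfEdgesDecidableAdj (n : ℕ) (E : List (Fin n × Fin n)) :
    DecidableRel (graphOfEdges n E).Adj :=
  fun u v => inferInstanceAs (Decidable (u ≠ v ∧ ((u, v) ∈ E ∨ (v, u) ∈ E)))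

instance : DecidableRel graphH1.Adj := graphOfEdgesDecidableAdj _ _
instance : DecidableRel graphH2.Adj := graphOfEdgesDecidableAdj _ _
instance : DecidableRel graphH3.Adj := graphOfEdgesDecidableAdj _ _
instance : DecidableRel graphH4.Adj := graphOfEdgesDecidableAdj _ _
instance : DecidableRel graphH5.Adj := graphOfEdgesDecidableAdj _ _
instance : DecidableRel graphH7.Adj := graphOfEdgesDecidableAdj _ _
instance : DecidableRel graphH14.Adj := graphOfEdgesDecidableAdj _ _
instance : DecidableRel graphH15.Adj := graphOfEdgesDecidableAdj _ _

theorem adj_of_graphOfEdges_adj {n : ℕ} {E : List (Fin n × Fin n)} {φ : Fin n → V}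
    (h : ∀ e ∈ E, G.Adj (φ e.1) (φ e.2)) (a b : Fin n) (hab : (graphOfEdges n E).Adj a b) :
    G.Adj (φ a) (φ b) := by
  rw [graphOfEdges, SimpleGraph.fromRel_adj] at hab
  rcases hab.2 with h1 | h1
  · exact h _ h1
  · exact (h _ h1).symm

/-- Row `u₀` of `c` colors the graph without `u₀`, and its entry at `u₀` is a dummy. The coloring
`d` also avoids one vertex, but measures distances in the whole graph, as the four-coloring
requires. -/
theorem isKSVertexCritical_of_colorings {n : ℕ} {H : SimpleGraph (Fin n)} [DecidableRel H.Adj]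
    {s : ℕ → ℕ} (hs1 : s 0 = 1) (hs2 : s 1 = 3) (hs3 : s 2 = 3) (hH : ¬ Packable H)
    (c : Fin n → Fin n → Fin 3)
    (hc : ∀ u₀ u v, u ≠ u₀ → v ≠ u₀ → u ≠ v → c u₀ u = c u₀ v → ¬ H.Adj u v ∧
      (c u₀ u ≠ 0 → ∀ w, H.Adj u w → w ≠ u₀ → ¬ H.Adj w v ∧
        ∀ x, H.Adj w x → x ≠ u₀ → ¬ H.Adj x v))
    (u₀ : Fin n) (d : Fin n → Fin 3)
    (hd : ∀ u v, u ≠ u₀ → v ≠ u₀ → u ≠ v → d u = d v → ¬ H.Adj u v ∧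
      (d u ≠ 0 → ∀ w, H.Adj u w → ¬ H.Adj w v ∧ ∀ x, H.Adj w x → ¬ H.Adj x v)) :
    IsKSVertexCritical s 4 H :=
  (isKSVertexCritical_four_iff hs1 hs2 hs3).2 ⟨hH, fun u => packable_induce_compl u (c u) (hc u),
    exists_four_coloring hs1 hs2 hs3 u₀ d hd⟩

theorem not_packable_top_four : ¬ Packable (⊤ : SimpleGraph (Fin 4)) := by
  rintro ⟨c, hc⟩
  obtain ⟨u, v, huv, h⟩ := Fintype.exists_ne_map_eq_of_card_lt c (by simp)
  exact hc.ne (u := u) (v := v) huv h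

/-- All three triangle vertices have three neighbors, so they would need three different nonzero
colors. -/
theorem not_packable_graphH3 : ¬ Packable graphH3 := by
  rintro ⟨c, hc⟩
  have h0 := hc.ne_zero (u := 0) (a := 1) (b := 2) (d := 3) (by decide) (by decide) (by decide)
    (by decide) (by decide) (by decide)
  have h1 := hc.ne_zero (u := 1) (a := 0) (b := 2) (d := 4) (by decide) (by decide) (by decide)
    (by decide) (by decide) (by decide)
  have h2 := hc.ne_zero (u := 2) (a := 0) (b := 1) (d := 5) (by decide) (by decide) (by decide)
    (by decide) (by decide) (by decide)
  have h3 := hc.ne (u := 0) (v := 1) (by decide)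
  have h4 := hc.ne (u := 0) (v := 2) (by decide)
  have h5 := hc.ne (u := 1) (v := 2) (by decide)
  omega

/-- The triangle uses every color. Vertex `3` is within distance two of all of it, hence has color
`0`, and vertex `4` is within distance three, hence has color `0` too. But they are adjacent. -/
theorem not_packable_graphH4 : ¬ Packable graphH4 := by
  rintro ⟨c, hc⟩
  have h1 := hc.ne_zero (u := 1) (a := 0) (b := 2) (d := 3) (by decide) (by decide) (by decide)
    (by decide) (by decide) (by decide)
  have h3 := hc.ne (u := 0) (v := 1) (by decide)
  have h4 := hc.ne (u := 0) (v := 2) (by decide)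
  have h5 := hc.ne (u := 1) (v := 2) (by decide)
  have h6 := hc.ne (u := 1) (v := 3) (by decide)
  have h7 := hc.ne (u := 3) (v := 4) (by decide)
  have h8 := hc.two (u := 3) (w := 1) (v := 0) (by decide) (by decide) (by decide)
  have h9 := hc.two (u := 3) (w := 1) (v := 2) (by decide) (by decide) (by decide)
  have h10 := hc.two (u := 4) (w := 3) (v := 1) (by decide) (by decide) (by decide)
  have h11 := hc.three (u := 4) (w := 3) (x := 1) (v := 0) (by decide) (by decide) (by decide)
    (by decide)
  have h12 := hc.three (u := 4) (w := 3) (x := 1) (v := 2) (by decide) (by decide) (by decide)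
    (by decide)
  omega

/-- Vertices `1` and `2` take both nonzero colors. Vertices `0` and `3` are within distance two of
both, which forces color `0` on two adjacent vertices. -/
theorem not_packable_graphH5 : ¬ Packable graphH5 := by
  rintro ⟨c, hc⟩
  have h1 := hc.ne_zero (u := 1) (a := 0) (b := 2) (d := 5) (by decide) (by decide) (by decide)
    (by decide) (by decide) (by decide)
  have h2 := hc.ne_zero (u := 2) (a := 1) (b := 3) (d := 4) (by decide) (by decide) (by decide)
    (by decide) (by decide) (by decide)
  have h3 := hc.ne (u := 1) (v := 2) (by decide)
  have h4 := hc.ne (u := 1) (v := 0) (by decide)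
  have h5 := hc.ne (u := 2) (v := 3) (by decide)
  have h6 := hc.ne (u := 0) (v := 3) (by decide)
  have h7 := hc.two (u := 0) (w := 1) (v := 2) (by decide) (by decide) (by decide)
  have h8 := hc.two (u := 3) (w := 2) (v := 1) (by decide) (by decide) (by decide)
  omega

/-- Vertices `2` and `3` take both nonzero colors. Vertices `1` and `0` are within distance three of
both, which forces color `0` on two adjacent vertices. -/
theorem not_packable_graphH14 : ¬ Packable graphH14 := by
  rintro ⟨c, hc⟩
  have h1 := hc.ne_zero (u := 2) (a := 1) (b := 3) (d := 5) (by decide) (by decide) (by decide)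
    (by decide) (by decide) (by decide)
  have h2 := hc.ne_zero (u := 3) (a := 2) (b := 4) (d := 6) (by decide) (by decide) (by decide)
    (by decide) (by decide) (by decide)
  have h3 := hc.ne (u := 2) (v := 3) (by decide)
  have h4 := hc.ne (u := 1) (v := 2) (by decide)
  have h5 := hc.ne (u := 0) (v := 1) (by decide)
  have h6 := hc.two (u := 1) (w := 2) (v := 3) (by decide) (by decide) (by decide)
  have h7 := hc.two (u := 0) (w := 1) (v := 2) (by decide) (by decide) (by decide)
  have h8 := hc.three (u := 0) (w := 1) (x := 2) (v := 3) (by decide) (by decide) (by decide)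
    (by decide)
  omega

theorem isKSVertexCritical_top_four {s : ℕ → ℕ} (hs1 : s 0 = 1) (hs2 : s 1 = 3) (hs3 : s 2 = 3) :
    IsKSVertexCritical s 4 (⊤ : SimpleGraph (Fin 4)) := by
  have key : ∀ u₀ u v : Fin 4, u ≠ u₀ → v ≠ u₀ → u ≠ v →
      (![![0, 0, 1, 2], ![0, 0, 1, 2], ![0, 1, 0, 2], ![0, 1, 2, 0]] : Fin 4 → Fin 4 → Fin 3) u₀ u ≠
      (![![0, 0, 1, 2], ![0, 0, 1, 2], ![0, 1, 0, 2], ![0, 1, 2, 0]] : Fin 4 → Fin 4 → Fin 3) u₀ v := by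
    decide +kernel
  exact isKSVertexCritical_of_colorings hs1 hs2 hs3 not_packable_top_four _
    (fun u₀ u v hu hv huv h => absurd h (key u₀ u v hu hv huv)) 0 _
    (fun u v hu hv huv h => absurd h (key 0 u v hu hv huv))

/-- Noncolorability is inherited from a spanning copy of `graphH4`, and the rows of the matrix are
explicit colorings of the vertex deletions. -/
theorem isKSVertexCritical_H1 {s : ℕ → ℕ} (hs1 : s 0 = 1) (hs2 : s 1 = 3) (hs3 : s 2 = 3) :
    IsKSVertexCritical s 4 (graphH1) := by
  refine isKSVertexCritical_of_colorings hs1 hs2 hs3 (fun h => not_packable_graphH4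
    (h.of_injective ![0, 1, 3, 2, 4] (by decide) (by decide)))
    (![![0, 0, 1, 2, 0], ![0, 0, 0, 1, 2], ![0, 1, 0, 2, 0], ![0, 1, 0, 0, 2], ![0, 1, 0, 2, 0]])
    (by decide +kernel) 0 ![0, 0, 1, 2, 0] (by decide +kernel)

theorem isKSVertexCritical_H2 {s : ℕ → ℕ} (hs1 : s 0 = 1) (hs2 : s 1 = 3) (hs3 : s 2 = 3) :
    IsKSVertexCritical s 4 (graphH2) := by
  refine isKSVertexCritical_of_colorings hs1 hs2 hs3 (fun h => not_packable_graphH4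
    (h.of_injective ![0, 2, 1, 3, 4] (by decide) (by decide)))
    (![![0, 0, 1, 0, 2], ![0, 0, 1, 0, 2], ![0, 1, 0, 0, 1], ![0, 1, 2, 0, 0], ![0, 1, 2, 0, 0]])
    (by decide +kernel) 0 ![0, 0, 1, 0, 2] (by decide +kernel)

theorem isKSVertexCritical_H3 {s : ℕ → ℕ} (hs1 : s 0 = 1) (hs2 : s 1 = 3) (hs3 : s 2 = 3) :
    IsKSVertexCritical s 4 (graphH3) := by
  refine isKSVertexCritical_of_colorings hs1 hs2 hs3 not_packable_graphH3
    (![![0, 0, 1, 0, 2, 0], ![0, 0, 1, 2, 0, 0], ![0, 1, 0, 2, 0, 0], ![0, 1, 2, 0, 0, 0], ![1, 0, 2, 0, 0, 0], ![1, 2, 0, 0, 0, 0]])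
    (by decide +kernel) 0 ![0, 0, 1, 0, 2, 0] (by decide +kernel)

theorem isKSVertexCritical_H4 {s : ℕ → ℕ} (hs1 : s 0 = 1) (hs2 : s 1 = 3) (hs3 : s 2 = 3) :
    IsKSVertexCritical s 4 (graphH4) := by
  refine isKSVertexCritical_of_colorings hs1 hs2 hs3 not_packable_graphH4
    (![![0, 0, 1, 2, 0], ![0, 0, 1, 0, 1], ![0, 1, 0, 0, 2], ![0, 1, 2, 0, 0], ![0, 1, 2, 0, 0]])
    (by decide +kernel) 0 ![0, 0, 1, 2, 0] (by decide +kernel)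

theorem isKSVertexCritical_H5 {s : ℕ → ℕ} (hs1 : s 0 = 1) (hs2 : s 1 = 3) (hs3 : s 2 = 3) :
    IsKSVertexCritical s 4 (graphH5) := by
  refine isKSVertexCritical_of_colorings hs1 hs2 hs3 not_packable_graphH5
    (![![0, 0, 1, 0, 0, 2], ![0, 0, 0, 1, 2, 0], ![0, 1, 0, 2, 0, 0], ![0, 1, 0, 0, 2, 0], ![0, 1, 0, 2, 0, 0], ![1, 0, 2, 0, 0, 0]])
    (by decide +kernel) 0 ![0, 0, 1, 0, 0, 2] (by decide +kernel)

theorem isKSVertexCritical_H7 {s : ℕ → ℕ} (hs1 : s 0 = 1) (hs2 : s 1 = 3) (hs3 : s 2 = 3) :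
    IsKSVertexCritical s 4 (graphH7) := by
  refine isKSVertexCritical_of_colorings hs1 hs2 hs3 (fun h => not_packable_graphH5
    (h.of_injective ![0, 1, 2, 3, 4, 5] (by decide) (by decide)))
    (![![0, 0, 1, 0, 0, 2], ![0, 0, 0, 1, 2, 0], ![0, 1, 0, 2, 0, 0], ![0, 1, 0, 0, 2, 0], ![0, 1, 0, 2, 0, 0], ![1, 0, 2, 0, 0, 0]])
    (by decide +kernel) 0 ![0, 0, 1, 0, 0, 2] (by decide +kernel)

theorem isKSVertexCritical_H14 {s : ℕ → ℕ} (hs1 : s 0 = 1) (hs2 : s 1 = 3) (hs3 : s 2 = 3) :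
    IsKSVertexCritical s 4 (graphH14) := by
  refine isKSVertexCritical_of_colorings hs1 hs2 hs3 not_packable_graphH14
    (![![0, 0, 1, 2, 0, 0, 0], ![0, 0, 0, 1, 0, 2, 0], ![0, 1, 0, 0, 1, 0, 2], ![0, 1, 0, 0, 0, 2, 0], ![1, 0, 2, 0, 0, 0, 1], ![0, 1, 0, 2, 0, 0, 0], ![1, 0, 2, 0, 1, 0, 0]])
    (by decide +kernel) 0 ![0, 0, 1, 2, 0, 0, 0] (by decide +kernel)

theorem isKSVertexCritical_H15 {s : ℕ → ℕ} (hs1 : s 0 = 1) (hs2 : s 1 = 3) (hs3 : s 2 = 3) :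
    IsKSVertexCritical s 4 (graphH15) := by
  refine isKSVertexCritical_of_colorings hs1 hs2 hs3 (fun h => not_packable_graphH14
    (h.of_injective ![0, 1, 2, 4, 5, 3, 6] (by decide) (by decide)))
    (![![0, 0, 1, 0, 2, 0, 0], ![0, 0, 0, 1, 2, 0, 0], ![0, 1, 0, 2, 0, 1, 2], ![0, 1, 0, 0, 2, 0, 0], ![0, 1, 0, 2, 0, 0, 0], ![1, 0, 2, 0, 0, 0, 1], ![1, 0, 2, 0, 0, 1, 0]])
    (by decide +kernel) 0 ![0, 0, 1, 0, 2, 0, 0] (by decide +kernel)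

theorem isKSVertexCritical_C5a {s : ℕ → ℕ} (hs1 : s 0 = 1) (hs2 : s 1 = 3) (hs3 : s 2 = 3) :
    IsKSVertexCritical s 4 (graphOfEdges 5 [(0, 1), (1, 2), (2, 3), (3, 4), (4, 0), (0, 2)]) := by
  refine isKSVertexCritical_of_colorings hs1 hs2 hs3 (fun h => not_packable_graphH4
    (h.of_injective ![0, 2, 1, 3, 4] (by decide) (by decide)))
    (![![0, 0, 1, 0, 2], ![0, 0, 1, 0, 2], ![0, 1, 0, 0, 2], ![1, 0, 2, 0, 0], ![0, 1, 2, 0, 0]])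
    (by decide +kernel) 0 ![0, 0, 1, 0, 2] (by decide +kernel)

theorem isKSVertexCritical_C5b {s : ℕ → ℕ} (hs1 : s 0 = 1) (hs2 : s 1 = 3) (hs3 : s 2 = 3) :
    IsKSVertexCritical s 4 (graphOfEdges 5 [(0, 1), (1, 2), (2, 3), (3, 4), (4, 0), (0, 2), (0, 3)]) := by
  refine isKSVertexCritical_of_colorings hs1 hs2 hs3 (fun h => not_packable_graphH4
    (h.of_injective ![0, 2, 1, 3, 4] (by decide) (by decide)))
    (![![0, 0, 1, 0, 2], ![1, 0, 0, 2, 0], ![1, 0, 0, 0, 2], ![1, 0, 2, 0, 0], ![1, 0, 2, 0, 0]])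
    (by decide +kernel) 0 ![0, 0, 1, 0, 2] (by decide +kernel)

theorem isKSVertexCritical_C5c {s : ℕ → ℕ} (hs1 : s 0 = 1) (hs2 : s 1 = 3) (hs3 : s 2 = 3) :
    IsKSVertexCritical s 4 (graphOfEdges 5 [(0, 1), (1, 2), (2, 3), (3, 4), (4, 0), (0, 2), (1, 3)]) := by
  refine isKSVertexCritical_of_colorings hs1 hs2 hs3 (fun h => not_packable_graphH4
    (h.of_injective ![0, 1, 2, 3, 4] (by decide) (by decide)))
    (![![0, 0, 1, 2, 0], ![0, 0, 1, 0, 2], ![0, 1, 0, 0, 2], ![1, 0, 2, 0, 0], ![0, 1, 2, 0, 0]])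
    (by decide +kernel) 0 ![0, 0, 1, 2, 0] (by decide +kernel)

theorem isKSVertexCritical_C5d {s : ℕ → ℕ} (hs1 : s 0 = 1) (hs2 : s 1 = 3) (hs3 : s 2 = 3) :
    IsKSVertexCritical s 4 (graphOfEdges 5 [(0, 1), (1, 2), (2, 3), (3, 4), (4, 0), (0, 2), (0, 3), (1, 4)]) := by
  refine isKSVertexCritical_of_colorings hs1 hs2 hs3 (fun h => not_packable_graphH4
    (h.of_injective ![0, 1, 2, 4, 3] (by decide) (by decide)))
    (![![0, 0, 1, 0, 2], ![1, 0, 0, 2, 0], ![1, 0, 0, 0, 2], ![1, 2, 0, 0, 0], ![1, 0, 2, 0, 0]])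
    (by decide +kernel) 0 ![0, 0, 1, 0, 2] (by decide +kernel)

/-- Noncolorability comes from the spanning six-cycle, whose order is not divisible by four. -/
theorem isKSVertexCritical_C6a {s : ℕ → ℕ} (hs1 : s 0 = 1) (hs2 : s 1 = 3) (hs3 : s 2 = 3) :
    IsKSVertexCritical s 4 (graphOfEdges 6 [(0, 1), (1, 2), (2, 3), (3, 4), (4, 5), (5, 0), (0, 3)]) := by
  refine isKSVertexCritical_of_colorings hs1 hs2 hs3 (fun h => not_packable_cycleGraph (n := 6) (by decide) (by decide)
    (h.of_injective ![0, 1, 2, 3, 4, 5] (by decide) (by decide)))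
    (![![0, 0, 1, 0, 2, 0], ![0, 0, 0, 1, 0, 2], ![1, 0, 0, 0, 2, 0], ![0, 1, 0, 0, 0, 2], ![1, 0, 2, 0, 0, 0], ![0, 1, 0, 2, 0, 0]])
    (by decide +kernel) 0 ![0, 0, 1, 0, 2, 0] (by decide +kernel)

theorem isKSVertexCritical_C6b {s : ℕ → ℕ} (hs1 : s 0 = 1) (hs2 : s 1 = 3) (hs3 : s 2 = 3) :
    IsKSVertexCritical s 4 (graphOfEdges 6 [(0, 1), (1, 2), (2, 3), (3, 4), (4, 5), (5, 0), (0, 3), (1, 4)]) := by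
  refine isKSVertexCritical_of_colorings hs1 hs2 hs3 (fun h => not_packable_cycleGraph (n := 6) (by decide) (by decide)
    (h.of_injective ![0, 1, 2, 3, 4, 5] (by decide) (by decide)))
    (![![0, 0, 1, 0, 2, 0], ![0, 0, 0, 1, 0, 2], ![1, 0, 0, 0, 2, 0], ![0, 1, 0, 0, 0, 2], ![1, 0, 2, 0, 0, 0], ![0, 1, 0, 2, 0, 0]])
    (by decide +kernel) 0 ![0, 0, 1, 0, 2, 0] (by decide +kernel)

theorem isKSVertexCritical_C6c {s : ℕ → ℕ} (hs1 : s 0 = 1) (hs2 : s 1 = 3) (hs3 : s 2 = 3) :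
    IsKSVertexCritical s 4 (graphOfEdges 6 [(0, 1), (1, 2), (2, 3), (3, 4), (4, 5), (5, 0), (0, 3), (1, 4), (2, 5)]) := by
  refine isKSVertexCritical_of_colorings hs1 hs2 hs3 (fun h => not_packable_cycleGraph (n := 6) (by decide) (by decide)
    (h.of_injective ![0, 1, 2, 3, 4, 5] (by decide) (by decide)))
    (![![0, 0, 1, 0, 2, 0], ![0, 0, 0, 1, 0, 2], ![1, 0, 0, 0, 2, 0], ![0, 1, 0, 0, 0, 2], ![1, 0, 2, 0, 0, 0], ![0, 1, 0, 2, 0, 0]])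
    (by decide +kernel) 0 ![0, 0, 1, 0, 2, 0] (by decide +kernel)

end SmallGraphs

/-! ### General properties of critical graphs -/

section Critical

variable {V W : Type*} {G : SimpleGraph V} {H : SimpleGraph W}

/-- `G` has no `(1, 3, 3)`-packing coloring, but all its vertex-deleted subgraphs have one. -/
structure IsPackingCritical (G : SimpleGraph V) : Prop where
  not_packable : ¬ Packable G
  packable_delete : ∀ u, Packable (G.induce {u}ᶜ)

namespace IsPackingCritical

/-- A missed vertex could be deleted without destroying the copy of `H`, and the deletion would
still be nonpackable. All later classification steps rest on this. -/
theorem surjective (hG : IsPackingCritical G) (hH : ¬ Packable H) {φ : W → V}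
    (hφ : Function.Injective φ) (hadj : ∀ a b, H.Adj a b → G.Adj (φ a) (φ b)) :
    Function.Surjective φ := by
  intro u
  by_contra hu
  refine hH ((hG.packable_delete u).of_injective (fun w => ⟨φ w, fun h => hu ⟨w, h⟩⟩) ?_ ?_)
  · intro a b hab
    exact hφ (congrArg Subtype.val hab)
  · exact fun a b hab => hadj a b hab

theorem natCard_eq (hG : IsPackingCritical G) (hH : ¬ Packable H) {φ : W → V}
    (hφ : Function.Injective φ) (hadj : ∀ a b, H.Adj a b → G.Adj (φ a) (φ b)) :
    Nat.card V = Nat.card W :=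
  (Nat.card_eq_of_bijective φ ⟨hφ, hG.surjective hH hφ hadj⟩).symm

theorem comap (hG : IsPackingCritical G) {φ : W → V} (hφ : Function.Bijective φ) :
    IsPackingCritical (G.comap φ) where
  not_packable h := by
    let e := Equiv.ofBijective φ hφ
    refine hG.not_packable (h.of_injective e.symm e.symm.injective fun a b hab => ?_)
    change G.Adj (e (e.symm a)) (e (e.symm b))
    simpa using hab
  packable_delete u := by
    refine (hG.packable_delete (φ u)).of_injective
      (fun w => ⟨φ w.1, fun h => w.2 (hφ.1 h)⟩) ?_ fun a b hab => hab
    intro a b hab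
    exact Subtype.ext (hφ.1 (congrArg Subtype.val hab))

theorem exists_coloring_delete (hG : IsPackingCritical G) (u₀ : V) :
    ∃ c : V → Fin 3, ∀ u v, u ≠ u₀ → v ≠ u₀ → u ≠ v → c u = c v → ¬ G.Adj u v ∧
      (c u ≠ 0 → ∀ w, G.Adj u w → w ≠ u₀ → ¬ G.Adj w v ∧
        ∀ x, G.Adj w x → x ≠ u₀ → ¬ G.Adj x v) := by
  classical
  obtain ⟨c, hc⟩ := hG.packable_delete u₀
  refine ⟨fun v => if h : v = u₀ then 0 else c ⟨v, h⟩, fun u v hu hv huv h => ?_⟩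
  simp only [hu, hv, dif_neg, not_false_eq_true] at h ⊢
  obtain ⟨h1, h2⟩ := hc ⟨u, hu⟩ ⟨v, hv⟩ (fun h => huv (congrArg Subtype.val h)) h
  exact ⟨h1, fun h0 w hw hwu => ⟨(h2 h0 ⟨w, hwu⟩ hw).1,
    fun x hx hxu => (h2 h0 ⟨w, hwu⟩ hw).2 ⟨x, hxu⟩ hx⟩⟩

/-- A nonempty set of vertices closed under adjacency is everything. -/
theorem mem_of_closed (hG : IsPackingCritical G) {S : Set V} {a : V} (ha : a ∈ S)
    (hS : ∀ u ∈ S, ∀ v, G.Adj u v → v ∈ S) (b : V) : b ∈ S := by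
  classical
  by_contra hb
  obtain ⟨c, hc⟩ := hG.exists_coloring_delete b
  obtain ⟨d, hd⟩ := hG.exists_coloring_delete a
  have hS' : ∀ u, u ∉ S → ∀ v, G.Adj u v → v ∉ S := fun u hu v huv hv => hu (hS v hv u huv.symm)
  have hSb : ∀ u ∈ S, u ≠ b := fun u hu h => hb (h ▸ hu)
  have hSa : ∀ u, u ∉ S → u ≠ a := fun u hu h => hu (h ▸ ha)
  -- No edge joins `S` to its complement. Deleting `b` leaves `S` intact and deleting `a` leaves the
  -- complement intact, so the two colorings glue.
  refine hG.not_packable ⟨fun v => if v ∈ S then c v else d v, fun u v huv h => ?_⟩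
  by_cases hu : u ∈ S
  · by_cases hv : v ∈ S
    · simp only [hu, hv, if_true] at h ⊢
      obtain ⟨h1, h2⟩ := hc u v (hSb u hu) (hSb v hv) huv h
      refine ⟨h1, fun h0 w hw => ?_⟩
      have hwS := hS u hu w hw
      obtain ⟨h3, h4⟩ := h2 h0 w hw (hSb w hwS)
      exact ⟨h3, fun x hx => h4 x hx (hSb x (hS w hwS x hx))⟩
    · exact ⟨fun h => hv (hS u hu v h), fun _ w hw => ⟨fun h => hv (hS w (hS u hu w hw) v h),
        fun x hx h => hv (hS x (hS w (hS u hu w hw) x hx) v h)⟩⟩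
  · by_cases hv : v ∈ S
    · exact ⟨fun h => hS' u hu v h hv, fun _ w hw => ⟨fun h => hS' w (hS' u hu w hw) v h hv,
        fun x hx h => hS' x (hS' w (hS' u hu w hw) x hx) v h hv⟩⟩
    · simp only [hu, hv, if_false] at h ⊢
      obtain ⟨h1, h2⟩ := hd u v (hSa u hu) (hSa v hv) huv h
      refine ⟨h1, fun h0 w hw => ?_⟩
      have hwS := hS' u hu w hw
      obtain ⟨h3, h4⟩ := h2 h0 w hw (hSa w hwS)
      exact ⟨h3, fun x hx => h4 x hx (hSa x (hS' w hwS x hx))⟩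

theorem nonempty (hG : IsPackingCritical G) : Nonempty V := by
  by_contra h
  rw [not_nonempty_iff] at h
  exact hG.not_packable ⟨fun v => h.elim v, fun v => h.elim v⟩

theorem connected (hG : IsPackingCritical G) : G.Connected := by
  have := hG.nonempty
  exact ⟨fun a b => hG.mem_of_closed (S := {v | G.Reachable a v}) (SimpleGraph.Reachable.refl a)
    (fun u hu v huv => SimpleGraph.Reachable.trans hu huv.reachable) b⟩

end IsPackingCritical

end Critical

/-! ### Distance levels in triangle-free graphs without bad cycles -/

section Levels

variable {V : Type*} {G : SimpleGraph V}

theorem exists_adj_dist_add_one (hG : G.Connected) {r u : V} (h : 0 < G.dist r u) :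
    ∃ w, G.Adj w u ∧ G.dist r w + 1 = G.dist r u := by
  obtain ⟨p, hp⟩ := hG.exists_walk_length_eq_dist u r
  rw [SimpleGraph.dist_comm] at hp
  match p with
  | .nil => simp at h
  | .cons (v := w) h1 q =>
    refine ⟨w, h1.symm, ?_⟩
    rw [SimpleGraph.Walk.length_cons] at hp
    have h2 := SimpleGraph.dist_le q
    rw [SimpleGraph.dist_comm] at h2
    have h3 := hG.dist_triangle (u := r) (v := w) (w := u)
    rw [SimpleGraph.dist_eq_one_iff_adj.2 h1.symm] at h3
    omega

theorem dist_le_dist_add_one_of_adj (hG : G.Connected) (r : V) {u v : V} (h : G.Adj u v) :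
    G.dist r v ≤ G.dist r u + 1 := by
  have h3 := hG.dist_triangle (u := r) (v := u) (w := v)
  rwa [SimpleGraph.dist_eq_one_iff_adj.2 h] at h3

theorem exists_geodesic (hG : G.Connected) (x y : V) :
    ∃ p : ℕ → V, p 0 = x ∧ p (G.dist x y) = y ∧
      (∀ i, i < G.dist x y → G.Adj (p i) (p (i + 1))) ∧
      (∀ i, i ≤ G.dist x y → G.dist x (p i) = i) := by
  obtain ⟨d, hd⟩ : ∃ d, G.dist x y = d := ⟨_, rfl⟩
  rw [hd]
  induction d generalizing y with
  | zero =>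
    have : x = y := hG.dist_eq_zero_iff.1 hd
    exact ⟨fun _ => x, rfl, this, fun i hi => absurd hi (by omega), fun i hi => by
      obtain rfl : i = 0 := by omega
      simp⟩
  | succ d ih =>
    obtain ⟨w, hw, hwd⟩ := exists_adj_dist_add_one hG (r := x) (u := y) (by omega)
    obtain ⟨p, h1, h2, h3, h4⟩ := ih w (by omega)
    refine ⟨fun i => if i ≤ d then p i else y, by simpa using h1, by simp, fun i hi => ?_,
      fun i hi => ?_⟩
    · by_cases hid : i = d
      · subst hid
        simpa [h2] using hw
      · simpa [show i ≤ d by omega, show i + 1 ≤ d by omega] using h3 i (by omega)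
    · by_cases hid : i ≤ d
      · simpa [hid] using h4 i hid
      · simp [hid, hd]
        omega

/-- Two geodesics from the root to vertices of the same level branch off somewhere. -/
theorem exists_branch (hG : G.Connected) (r : V) (d : ℕ) :
    ∀ u v, G.dist r u = d → G.dist r v = d → u ≠ v → ∃ (j : ℕ) (f : ℕ → V), 1 ≤ j ∧ j ≤ d ∧
      f 0 = u ∧ f (2 * j) = v ∧ (∀ i, i ≤ 2 * j → G.dist r (f i) + min i (2 * j - i) = d) ∧
      (∀ i, i < 2 * j → G.Adj (f i) (f (i + 1))) ∧
      (∀ i i', i < i' → i' ≤ 2 * j → f i ≠ f i') := by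
  induction d with
  | zero =>
    intro u v hu hv huv
    exact absurd ((hG.dist_eq_zero_iff.1 hu).symm.trans (hG.dist_eq_zero_iff.1 hv)) huv
  | succ d ih =>
    intro u v hu hv huv
    obtain ⟨u', hu', hud⟩ := exists_adj_dist_add_one hG (r := r) (u := u) (by omega)
    obtain ⟨v', hv', hvd⟩ := exists_adj_dist_add_one hG (r := r) (u := v) (by omega)
    -- If the two parents coincide, the branch below is a single vertex with `j = 0`, a case that
    -- the induction hypothesis does not include.
    have main : ∃ (j : ℕ) (f : ℕ → V), j ≤ d ∧ f 0 = u' ∧ f (2 * j) = v' ∧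
        (∀ i, i ≤ 2 * j → G.dist r (f i) + min i (2 * j - i) = d) ∧
        (∀ i, i < 2 * j → G.Adj (f i) (f (i + 1))) ∧
        (∀ i i', i < i' → i' ≤ 2 * j → f i ≠ f i') := by
      by_cases h : u' = v'
      · refine ⟨0, fun _ => u', by omega, rfl, h, fun i hi => ?_, fun i hi => absurd hi (by omega),
          fun i i' h1 h2 => absurd h1 (by omega)⟩
        simp only
        omega
      · obtain ⟨j, f, -, h⟩ := ih u' v' (by omega) (by omega) h
        exact ⟨j, f, h⟩
    obtain ⟨j, f, hj, hf0, hfj, hlev, hadj, hinj⟩ := main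
    -- The new sequence is `f` shifted by one, with `u` in front and `v` at the end. The inner terms
    -- have level at most `d`, so they avoid `u` and `v`.
    have e0 : ∀ g : ℕ → V, (fun i => if i = 0 then u else if i ≤ 2 * j + 1 then f (i - 1) else v) =
        g → g 0 = u ∧ (∀ i, i ≤ 2 * j → g (i + 1) = f i) ∧ g (2 * j + 2) = v := by
      rintro g rfl
      refine ⟨rfl, fun i hi => ?_, ?_⟩
      · simp [hi]
      · simp
    obtain ⟨g, hg⟩ : ∃ g : ℕ → V, (fun i => if i = 0 then u else if i ≤ 2 * j + 1 then f (i - 1)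
      else v) = g := ⟨_, rfl⟩
    obtain ⟨g0, g1, g2⟩ := e0 g hg
    have glev : ∀ i, i ≤ 2 * j → G.dist r (g (i + 1)) ≤ d := by
      intro i hi
      have := hlev i hi
      rw [g1 i hi]
      omega
    refine ⟨j + 1, g, by omega, by omega, g0, g2, ?_, ?_, ?_⟩
    · intro i hi
      rcases i with _ | i
      · rw [g0]
        omega
      · rcases Nat.lt_or_ge (2 * j) i with h | h
        · obtain rfl : i = 2 * j + 1 := by omega
          rw [g2]
          omega
        · have := hlev i h
          rw [g1 i h]
          omega
    · intro i hi
      rcases i with _ | i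
      · rw [g0, g1 0 (by omega), hf0]
        exact hu'.symm
      · rcases Nat.lt_or_ge i (2 * j) with h | h
        · rw [g1 i h.le, g1 (i + 1) h]
          exact hadj i h
        · obtain rfl : i = 2 * j := by omega
          rw [g1 _ le_rfl, g2, hfj]
          exact hv'
    · intro i i' hii' hi'
      rcases i' with _ | i'
      · omega
      rcases i with _ | i
      · rw [g0]
        rcases Nat.lt_or_ge (2 * j) i' with h | h
        · obtain rfl : i' = 2 * j + 1 := by omega
          rwa [g2]
        · intro h'
          have := glev i' h
          rw [← h'] at this
          omega
      · rcases Nat.lt_or_ge (2 * j) i' with h | h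
        · obtain rfl : i' = 2 * j + 1 := by omega
          rw [g2]
          intro h'
          have := glev i (by omega)
          rw [h'] at this
          omega
        · rw [g1 i (by omega), g1 i' h]
          exact hinj _ _ (by omega) h

/-- `G` contains a cycle, as a subgraph, of order at least five and not divisible by four. -/
def HasBadCycle (G : SimpleGraph V) : Prop :=
  ∃ (n : ℕ) (f : ℕ → V), 5 ≤ n ∧ n % 4 ≠ 0 ∧ (∀ i j, i < j → j < n → f i ≠ f j) ∧
    (∀ i, i + 1 < n → G.Adj (f i) (f (i + 1))) ∧ G.Adj (f (n - 1)) (f 0)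

/-- No three vertices of `G` are pairwise adjacent. -/
def TriangleFree (G : SimpleGraph V) : Prop :=
  ∀ a b c, G.Adj a b → G.Adj b c → ¬ G.Adj a c

/-- `x` has at least three neighbors. -/
def HasThreeNeighbors (G : SimpleGraph V) (x : V) : Prop :=
  ∃ a b c, G.Adj x a ∧ G.Adj x b ∧ G.Adj x c ∧ a ≠ b ∧ a ≠ c ∧ b ≠ c

theorem HasThreeNeighbors.exists_two {x : V} (h : HasThreeNeighbors G x) (z : V) :
    ∃ a b, G.Adj x a ∧ G.Adj x b ∧ a ≠ b ∧ a ≠ z ∧ b ≠ z := by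
  obtain ⟨a, b, c, ha, hb, hc, hab, hac, hbc⟩ := h
  by_cases h1 : a = z
  · exact ⟨b, c, hb, hc, hbc, h1 ▸ hab.symm, h1 ▸ hac.symm⟩
  · by_cases h2 : b = z
    · exact ⟨a, c, ha, hc, hac, h1, h2 ▸ hbc.symm⟩
    · exact ⟨a, b, ha, hb, hab, h1, h2⟩

/-- An edge inside a level closes the branch between its ends to a cycle of odd order `2 * j + 1`: a
triangle or a bad cycle. -/
theorem dist_ne_of_adj (hG : G.Connected) (htri : TriangleFree G) (hcyc : ¬ HasBadCycle G) (r : V)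
    {u v : V} (h : G.Adj u v) : G.dist r u ≠ G.dist r v := by
  intro huv
  obtain ⟨j, f, hj, -, hf0, hfj, -, hadj, hinj⟩ := exists_branch hG r _ u v huv rfl h.ne
  by_cases hj1 : j = 1
  · subst hj1
    have h1 := hadj 0 (by omega)
    have h2 := hadj 1 (by omega)
    rw [hf0] at h1
    rw [show 1 + 1 = 2 * 1 by rfl, hfj] at h2
    exact htri _ _ _ h1 h2 h
  · refine hcyc ⟨2 * j + 1, f, by omega, by omega, fun i i' h1 h2 => hinj i i' h1 (by omega),
      fun i hi => hadj i (by omega), ?_⟩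
    rw [show 2 * j + 1 - 1 = 2 * j by omega, hfj, hf0]
    exact h.symm

theorem dist_eq_add_one_of_adj (hG : G.Connected) (htri : TriangleFree G)
    (hcyc : ¬ HasBadCycle G) (r : V) {u v : V} (h : G.Adj u v) :
    G.dist r u = G.dist r v + 1 ∨ G.dist r v = G.dist r u + 1 := by
  have h1 := dist_le_dist_add_one_of_adj hG r h
  have h2 := dist_le_dist_add_one_of_adj hG r h.symm
  have h3 := dist_ne_of_adj hG htri hcyc r h
  omega

/-- Two vertices of one even level with a common neighbor lead either to a cycle of order `2` modulo
`4` or to an odd-level vertex with two children and a parent. -/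
theorem packable_of_odd_levels (hG : G.Connected) (htri : TriangleFree G)
    (hcyc : ¬ HasBadCycle G) (r : V)
    (hodd : ∀ v, G.dist r v % 2 = 1 → ¬ HasThreeNeighbors G v) : Packable G := by
  refine packable_of_level (G.dist r) (fun u v h => dist_eq_add_one_of_adj hG htri hcyc r h) ?_
  intro u v w huv huv' heven huw hwv
  obtain ⟨j, f, hj, hjd, hf0, hfj, hlev, hadj, hinj⟩ := exists_branch hG r _ u v huv' rfl huv
  have hw1 := dist_eq_add_one_of_adj hG htri hcyc r huw
  -- If `w` were below, it would have `u`, `v` and its own parent as neighbors.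
  have hw : G.dist r w = G.dist r u + 1 := by
    rcases hw1 with h | h
    · exfalso
      obtain ⟨z, hz, hzd⟩ := exists_adj_dist_add_one hG (r := r) (u := w) (by omega)
      refine hodd w (by omega) ⟨u, v, z, huw.symm, hwv, hz.symm, huv, ?_, ?_⟩
      · rintro rfl
        omega
      · rintro rfl
        omega
    · exact h
  -- For even `j`, the branch and `w` form a cycle of order `2 * j + 2`, which is `2` modulo `4`.
  -- For odd `j`, the lowest vertex `f j` is on an odd level and has both branch neighbors and a
  -- parent.
  rcases Nat.even_or_odd j with ⟨m, hm⟩ | ⟨m, hm⟩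
  · have hfw : ∀ i, i ≤ 2 * j → f i ≠ w := by
      intro i hi h
      have := hlev i hi
      rw [h] at this
      omega
    refine hcyc ⟨2 * j + 2, fun i => if i ≤ 2 * j then f i else w, by omega, by omega, ?_, ?_, ?_⟩
    · intro i i' h1 h2
      simp only [show i ≤ 2 * j by omega, if_true]
      split_ifs with h3
      · exact hinj i i' h1 h3
      · exact hfw i (by omega)
    · intro i hi
      simp only [show i ≤ 2 * j by omega, if_true]
      split_ifs with h3
      · exact hadj i (by omega)
      · obtain rfl : i = 2 * j := by omega
        rw [hfj]
        exact hwv.symm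
    · simp only [show ¬ 2 * j + 2 - 1 ≤ 2 * j by omega, if_false, Nat.zero_le, if_true]
      rw [hf0]
      exact huw.symm
  · have h1 := hlev j (by omega)
    have h2 := hlev (j - 1) (by omega)
    have h3 := hlev (j + 1) (by omega)
    obtain ⟨z, hz, hzd⟩ := exists_adj_dist_add_one hG (r := r) (u := f j) (by omega)
    have h4 := hadj (j - 1) (by omega)
    rw [show j - 1 + 1 = j by omega] at h4
    refine hodd (f j) (by omega) ⟨f (j - 1), f (j + 1), z, h4.symm, hadj j (by omega), hz.symm,
      hinj _ _ (by omega) (by omega), ?_, ?_⟩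
    · rintro rfl
      omega
    · rintro rfl
      omega

/-- The level coloring fails from every root. An arbitrary root supplies `x`, and then `x` as root
supplies `y`. -/
theorem IsPackingCritical.exists_odd_dist (hG : IsPackingCritical G) (htri : TriangleFree G)
    (hcyc : ¬ HasBadCycle G) :
    ∃ x y, HasThreeNeighbors G x ∧ HasThreeNeighbors G y ∧ G.dist x y % 2 = 1 := by
  have key : ∀ r, ∃ v, G.dist r v % 2 = 1 ∧ HasThreeNeighbors G v := by
    intro r
    by_contra h
    push Not at h
    exact hG.not_packable (packable_of_odd_levels hG.connected htri hcyc r h)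
  obtain ⟨r⟩ := hG.nonempty
  obtain ⟨x, -, hx⟩ := key r
  obtain ⟨y, hxy, hy⟩ := key x
  exact ⟨x, y, hx, hy, hxy⟩

end Levels

/-! ### Critical graphs spanned by a given small graph -/

section Classification

variable {V : Type*} {G : SimpleGraph V}

/-- `G` is isomorphic to a cycle of order at least five and not divisible by four, or to one of
the other vertex-critical graphs. -/
def IsListed (G : SimpleGraph V) : Prop :=
  Nonempty (G ≃g (⊤ : SimpleGraph (Fin 4))) ∨
    (Nonempty (G ≃g graphH1) ∨ Nonempty (G ≃g graphH2) ∨ Nonempty (G ≃g graphH3) ∨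
      Nonempty (G ≃g graphH4) ∨ Nonempty (G ≃g graphH5) ∨ Nonempty (G ≃g graphH7) ∨
      Nonempty (G ≃g graphH14) ∨ Nonempty (G ≃g graphH15)) ∨
    (∃ H ∈ familyC5, Nonempty (G ≃g H)) ∨
    (∃ H ∈ familyC6, Nonempty (G ≃g H)) ∨
    (∃ n : ℕ, 5 ≤ n ∧ n % 4 ≠ 0 ∧ Nonempty (G ≃g SimpleGraph.cycleGraph n)) ∨
    (∃ k : ℕ, 3 ≤ k ∧ Nonempty (G ≃g graphG k))

theorem nonempty_iso_of_comap {W : Type*} {H : SimpleGraph W} {φ : W → V}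
    (hφ : Function.Bijective φ) (h : ∀ a b, G.Adj (φ a) (φ b) ↔ H.Adj a b) :
    Nonempty (G ≃g H) :=
  ⟨((⟨Equiv.ofBijective φ hφ, by
    intro a b
    exact h a b⟩ : H ≃g G)).symm⟩

theorem IsListed.of_iso {W : Type*} {H : SimpleGraph W} (e : G ≃g H) (h : IsListed H) :
    IsListed G := by
  have key : ∀ {U : Type} {K : SimpleGraph U}, Nonempty (H ≃g K) → Nonempty (G ≃g K) :=
    fun ⟨f⟩ => ⟨e.trans f⟩
  exact h.imp key (Or.imp (Or.imp key (Or.imp key (Or.imp key (Or.imp key (Or.imp key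
    (Or.imp key (Or.imp key key))))))) (Or.imp (fun ⟨K, hK, f⟩ => ⟨K, hK, key f⟩)
    (Or.imp (fun ⟨K, hK, f⟩ => ⟨K, hK, key f⟩) (Or.imp (fun ⟨n, h1, h2, f⟩ => ⟨n, h1, h2, key f⟩)
    (fun ⟨n, h1, f⟩ => ⟨n, h1, key f⟩)))))

theorem IsListed.of_comap {n : ℕ} {φ : Fin n → V} (hφ : Function.Bijective φ)
    (h : IsListed (G.comap φ)) : IsListed G := by
  obtain ⟨e⟩ := nonempty_iso_of_comap (G := G) (H := G.comap φ) hφ (fun _ _ => Iff.rfl)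
  exact h.of_iso e

theorem nonempty_iso_of_perm {n : ℕ} {K H : SimpleGraph (Fin n)} (σ : Fin n → Fin n)
    (hσ : Function.Injective σ) (h : ∀ a b, K.Adj (σ a) (σ b) ↔ H.Adj a b) :
    Nonempty (K ≃g H) :=
  nonempty_iso_of_comap (Finite.injective_iff_bijective.1 hσ) h

/-- Once the known edges `E` and the undecided pairs `X` are listed, only finitely many graphs
remain, and these can be checked by evaluation. -/
theorem exists_eq_graphOfEdges {n : ℕ} {K : SimpleGraph (Fin n)} (E X : List (Fin n × Fin n))
    (hE : ∀ e ∈ E, K.Adj e.1 e.2)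
    (hX : ∀ u v, u < v → K.Adj u v → (u, v) ∈ E ∨ (v, u) ∈ E ∨ (u, v) ∈ X) :
    ∃ l ∈ X.sublists, K = graphOfEdges n (E ++ l) := by
  classical
  refine ⟨X.filter fun e => K.Adj e.1 e.2, List.mem_sublists.2 List.filter_sublist, ?_⟩
  ext u v
  constructor
  · intro h
    rw [graphOfEdges, SimpleGraph.fromRel_adj]
    refine ⟨h.ne, ?_⟩
    rcases lt_or_gt_of_ne h.ne with huv | huv
    · have := hX u v huv h
      simp only [List.mem_append, List.mem_filter, decide_eq_true_eq]
      tauto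
    · have := hX v u huv h.symm
      have h' := h.symm
      simp only [List.mem_append, List.mem_filter, decide_eq_true_eq]
      tauto
  · refine adj_of_graphOfEdges_adj (φ := id) (fun e he => ?_) u v
    rcases List.mem_append.1 he with he | he
    · exact hE e he
    · simpa using (List.mem_filter.1 he).2

/-- A vertex-critical graph contains no smaller graph without a packing coloring. -/
theorem IsPackingCritical.not_adj_of_smaller {n m : ℕ} {K : SimpleGraph (Fin n)}
    (hK : IsPackingCritical K) {E : List (Fin n × Fin n)} (hE : ∀ e ∈ E, K.Adj e.1 e.2)
    {F : SimpleGraph (Fin m)} (hF : ¬ Packable F) (hmn : m ≠ n) {p : Fin n × Fin n}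
    (σ : Fin m → Fin n) (hσ : Function.Injective σ)
    (hadj : ∀ a b, F.Adj a b → (graphOfEdges n (p :: E)).Adj (σ a) (σ b)) : ¬ K.Adj p.1 p.2 := by
  intro hp
  have := hK.natCard_eq hF hσ fun a b hab =>
    adj_of_graphOfEdges_adj (φ := id) (List.forall_mem_cons.2 ⟨hp, hE⟩) _ _ (hadj a b hab)
  simp only [Nat.card_eq_fintype_card, Fintype.card_fin] at this
  exact hmn this.symm

theorem isListed_of_graphH4_hom (hG : IsPackingCritical G) {φ : Fin 5 → V}
    (hφ : Function.Injective φ) (hadj : ∀ a b, graphH4.Adj a b → G.Adj (φ a) (φ b)) :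
    IsListed G := by
  have hb : Function.Bijective φ := ⟨hφ, hG.surjective not_packable_graphH4 hφ hadj⟩
  refine IsListed.of_comap hb ?_
  have hK := hG.comap hb
  generalize hKe : G.comap φ = K at hK
  have hE : ∀ e ∈ [((0 : Fin 5), (1 : Fin 5)), (1, 2), (2, 0), (1, 3), (3, 4)], K.Adj e.1 e.2 := by
    rw [← hKe]
    intro e he
    refine hadj _ _ ?_
    revert e
    decide
  have hX : ∀ u v : Fin 5, u < v →
      (u, v) ∈ [((0 : Fin 5), (1 : Fin 5)), (1, 2), (2, 0), (1, 3), (3, 4)] ∨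
      (v, u) ∈ [((0 : Fin 5), (1 : Fin 5)), (1, 2), (2, 0), (1, 3), (3, 4)] ∨
      (u, v) ∈ [((0 : Fin 5), (3 : Fin 5)), (2, 3), (0, 4), (2, 4), (1, 4)] := by
    decide
  obtain ⟨l, hl, rfl⟩ := exists_eq_graphOfEdges _
    [((0 : Fin 5), (3 : Fin 5)), (2, 3), (0, 4), (2, 4), (1, 4)] hE
    (fun u v huv _ => hX u v huv)
  -- Each choice of extra edges creates a complete graph on four vertices, too small for a critical
  -- graph of order five, or gives one of seven listed graphs through an explicit relabeling.
  have key : ∀ l ∈ [((0 : Fin 5), (3 : Fin 5)), (2, 3), (0, 4), (2, 4), (1, 4)].sublists,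
      (∃ σ ∈ ([![0, 1, 2, 3], ![0, 1, 2, 4], ![0, 1, 3, 4], ![1, 2, 3, 4]] :
        List (Fin 4 → Fin 5)), Function.Injective σ ∧ ∀ a b, a ≠ b →
        (graphOfEdges 5 ([(0, 1), (1, 2), (2, 0), (1, 3), (3, 4)] ++ l)).Adj (σ a) (σ b)) ∨
      ∃ L ∈ ([[(0, 1), (1, 2), (2, 3), (3, 0), (1, 3), (2, 4)],
          [(0, 1), (1, 2), (2, 0), (2, 3), (3, 4), (4, 2)],
          [(0, 1), (1, 2), (2, 0), (1, 3), (3, 4)],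
          [(0, 1), (1, 2), (2, 3), (3, 4), (4, 0), (0, 2)],
          [(0, 1), (1, 2), (2, 3), (3, 4), (4, 0), (0, 2), (0, 3)],
          [(0, 1), (1, 2), (2, 3), (3, 4), (4, 0), (0, 2), (1, 3)],
          [(0, 1), (1, 2), (2, 3), (3, 4), (4, 0), (0, 2), (0, 3), (1, 4)]] :
          List (List (Fin 5 × Fin 5))),
        ∃ σ ∈ ([![0, 2, 1, 3, 4], ![1, 0, 2, 4, 3], ![2, 0, 1, 3, 4], ![1, 0, 2, 3, 4],
          ![0, 1, 2, 3, 4], ![0, 1, 3, 2, 4], ![1, 2, 0, 3, 4], ![1, 2, 0, 4, 3],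
          ![2, 0, 3, 1, 4]] : List (Fin 5 → Fin 5)), Function.Injective σ ∧ ∀ a b,
          (graphOfEdges 5 ([(0, 1), (1, 2), (2, 0), (1, 3), (3, 4)] ++ l)).Adj (σ a) (σ b) ↔
            (graphOfEdges 5 L).Adj a b := by
    decide +kernel
  rcases key l hl with ⟨σ, -, hσ, h⟩ | ⟨L, hL, σ, -, hσ, h⟩
  · have := hK.natCard_eq not_packable_top_four hσ (fun a b hab => h a b hab.ne)
    simp at this
  · have hiso := nonempty_iso_of_perm σ hσ h
    simp only [List.mem_cons, List.not_mem_nil, or_false] at hL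
    rcases hL with rfl | rfl | rfl | rfl | rfl | rfl | rfl
    · exact Or.inr (Or.inl (Or.inl hiso))
    · exact Or.inr (Or.inl (Or.inr (Or.inl hiso)))
    · exact Or.inr (Or.inl (Or.inr (Or.inr (Or.inr (Or.inl hiso)))))
    all_goals exact Or.inr (Or.inr (Or.inl ⟨_, by simp [familyC5], hiso⟩))

/-- Any additional edge creates a copy of `graphH4`, which has only five vertices. -/
theorem isListed_of_graphH3_hom (hG : IsPackingCritical G) {φ : Fin 6 → V}
    (hφ : Function.Injective φ) (hadj : ∀ a b, graphH3.Adj a b → G.Adj (φ a) (φ b)) :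
    IsListed G := by
  have hb : Function.Bijective φ := ⟨hφ, hG.surjective not_packable_graphH3 hφ hadj⟩
  refine IsListed.of_comap hb ?_
  have hK := hG.comap hb
  generalize hKe : G.comap φ = K at hK
  have hE : ∀ e ∈ [((0 : Fin 6), (1 : Fin 6)), (1, 2), (2, 0), (0, 3), (1, 4), (2, 5)],
      K.Adj e.1 e.2 := by
    rw [← hKe]
    intro e he
    refine hadj _ _ ?_
    revert e
    decide
  have hY : ∀ p ∈ [((0 : Fin 6), (4 : Fin 6)), (0, 5), (1, 3), (1, 5), (2, 3), (2, 4), (3, 4),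
      (3, 5), (4, 5)], ¬ K.Adj p.1 p.2 := by
    intro p hp
    have key : ∀ p ∈ [((0 : Fin 6), (4 : Fin 6)), (0, 5), (1, 3), (1, 5), (2, 3), (2, 4), (3, 4),
        (3, 5), (4, 5)], ∃ σ ∈ ([![0, 1, 4, 2, 5], ![0, 2, 5, 1, 4], ![0, 1, 3, 2, 5],
        ![1, 2, 5, 0, 3], ![0, 2, 3, 1, 4], ![1, 2, 4, 0, 3], ![0, 1, 2, 4, 3], ![0, 2, 1, 5, 3],
        ![0, 1, 2, 4, 5]] : List (Fin 5 → Fin 6)), Function.Injective σ ∧ ∀ a b,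
        graphH4.Adj a b → (graphOfEdges 6
          (p :: [(0, 1), (1, 2), (2, 0), (0, 3), (1, 4), (2, 5)])).Adj (σ a) (σ b) := by
      decide +kernel
    obtain ⟨σ, -, hσ, h⟩ := key p hp
    exact hK.not_adj_of_smaller hE not_packable_graphH4 (by decide) σ hσ h
  have hX : ∀ u v : Fin 6, u < v →
      (u, v) ∈ [((0 : Fin 6), (1 : Fin 6)), (1, 2), (2, 0), (0, 3), (1, 4), (2, 5)] ∨
      (v, u) ∈ [((0 : Fin 6), (1 : Fin 6)), (1, 2), (2, 0), (0, 3), (1, 4), (2, 5)] ∨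
      (u, v) ∈ [((0 : Fin 6), (4 : Fin 6)), (0, 5), (1, 3), (1, 5), (2, 3), (2, 4), (3, 4),
        (3, 5), (4, 5)] := by
    decide
  obtain ⟨l, hl, rfl⟩ := exists_eq_graphOfEdges _ [] hE (fun u v huv h => by
    rcases hX u v huv with h1 | h1 | h1
    · exact Or.inl h1
    · exact Or.inr (Or.inl h1)
    · exact absurd h (hY _ h1))
  obtain rfl : l = [] := by simpa using hl
  exact Or.inr (Or.inl (Or.inr (Or.inr (Or.inl ⟨SimpleGraph.Iso.refl⟩))))

theorem hasBadCycle_of_hom {n : ℕ} (hn : 5 ≤ n) (hn4 : n % 4 ≠ 0) {φ : Fin n → V}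
    (hφ : Function.Injective φ)
    (hadj : ∀ a b, (SimpleGraph.cycleGraph n).Adj a b → G.Adj (φ a) (φ b)) : HasBadCycle G := by
  refine ⟨n, fun i => φ (cyclePoint (by omega) i), hn, hn4, fun i j hij hj h => ?_,
    fun i _ => hadj _ _ (cyclePoint_adj (by omega) i), hadj _ _ ?_⟩
  · have := Fin.ext_iff.1 (hφ h)
    simp only [cyclePoint] at this
    rw [Nat.mod_eq_of_lt hj, Nat.mod_eq_of_lt (by omega)] at this
    omega
  · have := cyclePoint_adj (n := n) (by omega) (n - 1)
    have e : cyclePoint (n := n) (by omega) (n - 1 + 1) = cyclePoint (by omega) 0 :=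
      Fin.ext (by simp [cyclePoint, show n - 1 + 1 = n by omega])
    rwa [e] at this

/-- Half of the possible extra edges violate the bipartition given by `q`. Of the rest, all but the
pair `0`, `5` create the smaller graph `graphH5`, and that pair gives `graphH15`. -/
theorem isListed_of_graphH14_hom (hG : IsPackingCritical G) {q : V → ℕ}
    (hq : ∀ u v, G.Adj u v → q u % 2 ≠ q v % 2) {φ : Fin 7 → V}
    (hφ : Function.Injective φ) (hadj : ∀ a b, graphH14.Adj a b → G.Adj (φ a) (φ b)) :
    IsListed G := by
  have hb : Function.Bijective φ := ⟨hφ, hG.surjective not_packable_graphH14 hφ hadj⟩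
  refine IsListed.of_comap hb ?_
  have hK := hG.comap hb
  generalize hKe : G.comap φ = K at hK
  have hE : ∀ e ∈ [((0 : Fin 7), (1 : Fin 7)), (1, 2), (2, 3), (3, 4), (2, 5), (3, 6)],
      K.Adj e.1 e.2 := by
    rw [← hKe]
    intro e he
    refine hadj _ _ ?_
    revert e
    decide
  have hqK : ∀ u v, K.Adj u v → q (φ u) % 2 ≠ q (φ v) % 2 := by
    rw [← hKe]
    exact fun u v h => hq _ _ h
  have hY : ∀ p ∈ [((0 : Fin 7), (3 : Fin 7)), (1, 4), (1, 6), (4, 5), (5, 6)],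
      ¬ K.Adj p.1 p.2 := by
    intro p hp
    have key : ∀ p ∈ [((0 : Fin 7), (3 : Fin 7)), (1, 4), (1, 6), (4, 5), (5, 6)],
        ∃ σ ∈ ([![0, 3, 2, 1, 5, 4], ![1, 2, 3, 4, 6, 5], ![1, 2, 3, 6, 4, 5],
        ![4, 3, 2, 5, 1, 6], ![5, 2, 3, 6, 4, 1]] : List (Fin 6 → Fin 7)),
        Function.Injective σ ∧ ∀ a b, graphH5.Adj a b → (graphOfEdges 7
          (p :: [(0, 1), (1, 2), (2, 3), (3, 4), (2, 5), (3, 6)])).Adj (σ a) (σ b) := by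
      decide +kernel
    obtain ⟨σ, -, hσ, h⟩ := key p hp
    exact hK.not_adj_of_smaller hE not_packable_graphH5 (by decide) σ hσ h
  have hZ : ∀ p ∈ [((0 : Fin 7), (2 : Fin 7)), (0, 4), (0, 6), (1, 3), (1, 5), (2, 4), (2, 6),
      (3, 5), (4, 6)], ¬ K.Adj p.1 p.2 := by
    have hE' := fun e he => hqK _ _ (hE e he)
    intro p hp h
    have h' := hqK _ _ h
    simp only [List.forall_mem_cons] at hE'
    simp only [List.mem_cons, List.not_mem_nil, or_false] at hp
    rcases hp with rfl | rfl | rfl | rfl | rfl | rfl | rfl | rfl | rfl <;> dsimp only at h' <;>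
      omega
  have hX : ∀ u v : Fin 7, u < v →
      (u, v) ∈ [((0 : Fin 7), (1 : Fin 7)), (1, 2), (2, 3), (3, 4), (2, 5), (3, 6)] ∨
      (u, v) ∈ [((0 : Fin 7), (5 : Fin 7))] ∨
      (u, v) ∈ [((0 : Fin 7), (3 : Fin 7)), (1, 4), (1, 6), (4, 5), (5, 6)] ∨
      (u, v) ∈ [((0 : Fin 7), (2 : Fin 7)), (0, 4), (0, 6), (1, 3), (1, 5), (2, 4), (2, 6),
        (3, 5), (4, 6)] := by
    decide
  obtain ⟨l, hl, rfl⟩ := exists_eq_graphOfEdges _ [((0 : Fin 7), (5 : Fin 7))] hE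
    (fun u v huv h => by
      rcases hX u v huv with h1 | h1 | h1 | h1
      · exact Or.inl h1
      · exact Or.inr (Or.inr h1)
      · exact absurd h (hY _ h1)
      · exact absurd h (hZ _ h1))
  have hl' : l = [] ∨ l = [((0 : Fin 7), (5 : Fin 7))] := by
    simpa [List.sublists] using hl
  rcases hl' with rfl | rfl
  · exact Or.inr (Or.inl (Or.inr (Or.inr (Or.inr (Or.inr (Or.inr (Or.inr (Or.inl
      ⟨SimpleGraph.Iso.refl⟩))))))))
  · exact Or.inr (Or.inl (Or.inr (Or.inr (Or.inr (Or.inr (Or.inr (Or.inr (Or.inr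
      (nonempty_iso_of_perm ![0, 1, 2, 5, 3, 4, 6] (by decide) (by decide +kernel))))))))))

/-- The bipartition leaves three possible extra edges. The edge between the two pendant vertices, or
the other two edges together, would create a six-cycle. One of those two alone gives `graphH7`. -/
theorem isListed_of_graphH5_hom (hG : IsPackingCritical G) (hcyc : ¬ HasBadCycle G) {q : V → ℕ}
    (hq : ∀ u v, G.Adj u v → q u % 2 ≠ q v % 2) {φ : Fin 6 → V}
    (hφ : Function.Injective φ) (hadj : ∀ a b, graphH5.Adj a b → G.Adj (φ a) (φ b)) :
    IsListed G := by
  have hb : Function.Bijective φ := ⟨hφ, hG.surjective not_packable_graphH5 hφ hadj⟩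
  refine IsListed.of_comap hb ?_
  have hK := hG.comap hb
  have hcycK : ∀ σ : Fin 6 → Fin 6, Function.Injective σ → ¬ ∀ a b,
      (SimpleGraph.cycleGraph 6).Adj a b → (G.comap φ).Adj (σ a) (σ b) := fun σ hσ h =>
    hcyc (hasBadCycle_of_hom (by decide) (by decide) (hφ.comp hσ) h)
  generalize hKe : G.comap φ = K at hK hcycK
  have hE : ∀ e ∈ [((0 : Fin 6), (1 : Fin 6)), (1, 2), (2, 3), (3, 0), (2, 4), (1, 5)],
      K.Adj e.1 e.2 := by
    rw [← hKe]
    intro e he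
    refine hadj _ _ ?_
    revert e
    decide
  have hqK : ∀ u v, K.Adj u v → q (φ u) % 2 ≠ q (φ v) % 2 := by
    rw [← hKe]
    exact fun u v h => hq _ _ h
  have hZ : ∀ p ∈ [((0 : Fin 6), (2 : Fin 6)), (0, 5), (1, 3), (1, 4), (2, 5), (3, 4)],
      ¬ K.Adj p.1 p.2 := by
    have hE' := fun e he => hqK _ _ (hE e he)
    intro p hp h
    have h' := hqK _ _ h
    simp only [List.forall_mem_cons] at hE'
    simp only [List.mem_cons, List.not_mem_nil, or_false] at hp
    rcases hp with rfl | rfl | rfl | rfl | rfl | rfl <;> dsimp only at h' <;> omega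
  have hX : ∀ u v : Fin 6, u < v →
      (u, v) ∈ [((0 : Fin 6), (1 : Fin 6)), (1, 2), (2, 3), (3, 0), (2, 4), (1, 5)] ∨
      (v, u) ∈ [((0 : Fin 6), (1 : Fin 6)), (1, 2), (2, 3), (3, 0), (2, 4), (1, 5)] ∨
      (u, v) ∈ [((0 : Fin 6), (4 : Fin 6)), (3, 5), (4, 5)] ∨
      (u, v) ∈ [((0 : Fin 6), (2 : Fin 6)), (0, 5), (1, 3), (1, 4), (2, 5), (3, 4)] := by
    decide
  obtain ⟨l, hl, rfl⟩ := exists_eq_graphOfEdges _ [((0 : Fin 6), (4 : Fin 6)), (3, 5), (4, 5)] hE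
    (fun u v huv h => by
      rcases hX u v huv with h1 | h1 | h1 | h1
      · exact Or.inl h1
      · exact Or.inr (Or.inl h1)
      · exact Or.inr (Or.inr h1)
      · exact absurd h (hZ _ h1))
  have key : ∀ l ∈ [((0 : Fin 6), (4 : Fin 6)), (3, 5), (4, 5)].sublists,
      (∃ σ ∈ ([![0, 1, 5, 4, 2, 3], ![0, 1, 5, 3, 2, 4]] : List (Fin 6 → Fin 6)),
        Function.Injective σ ∧ ∀ a b, (SimpleGraph.cycleGraph 6).Adj a b → (graphOfEdges 6
          ([(0, 1), (1, 2), (2, 3), (3, 0), (2, 4), (1, 5)] ++ l)).Adj (σ a) (σ b)) ∨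
      ∃ L ∈ ([[(0, 1), (1, 2), (2, 3), (3, 0), (2, 4), (1, 5)],
          [(0, 1), (1, 2), (2, 3), (3, 0), (1, 5), (3, 5), (2, 4)]] :
          List (List (Fin 6 × Fin 6))),
        ∃ σ ∈ ([![3, 0, 1, 2, 5, 4], ![0, 1, 2, 3, 4, 5]] : List (Fin 6 → Fin 6)),
          Function.Injective σ ∧ ∀ a b, (graphOfEdges 6
            ([(0, 1), (1, 2), (2, 3), (3, 0), (2, 4), (1, 5)] ++ l)).Adj (σ a) (σ b) ↔
            (graphOfEdges 6 L).Adj a b := by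
    decide +kernel
  rcases key l hl with ⟨σ, -, hσ, h⟩ | ⟨L, hL, σ, -, hσ, h⟩
  · exact absurd h (hcycK σ hσ)
  · have hiso := nonempty_iso_of_perm σ hσ h
    simp only [List.mem_cons, List.not_mem_nil, or_false] at hL
    rcases hL with rfl | rfl
    · exact Or.inr (Or.inl (Or.inr (Or.inr (Or.inr (Or.inr (Or.inl hiso))))))
    · exact Or.inr (Or.inl (Or.inr (Or.inr (Or.inr (Or.inr (Or.inr (Or.inl hiso)))))))

/-- Short chords would create triangles, so only long diagonals remain, and up to rotation just
their number matters. -/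
theorem isListed_of_cycleGraph_six_hom (hG : IsPackingCritical G) (htri : TriangleFree G)
    {φ : Fin 6 → V} (hφ : Function.Injective φ)
    (hadj : ∀ a b, (SimpleGraph.cycleGraph 6).Adj a b → G.Adj (φ a) (φ b)) : IsListed G := by
  have hb : Function.Bijective φ :=
    ⟨hφ, hG.surjective (not_packable_cycleGraph (by decide) (by decide)) hφ hadj⟩
  refine IsListed.of_comap hb ?_
  have htriK : TriangleFree (G.comap φ) := fun a b c h1 h2 h3 => htri _ _ _ h1 h2 h3
  generalize hKe : G.comap φ = K at htriK
  have hE : ∀ e ∈ [((0 : Fin 6), (1 : Fin 6)), (1, 2), (2, 3), (3, 4), (4, 5), (5, 0)],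
      K.Adj e.1 e.2 := by
    rw [← hKe]
    intro e he
    refine hadj _ _ ?_
    revert e
    decide
  have hZ : ∀ p ∈ [((0 : Fin 6), (2 : Fin 6)), (1, 3), (2, 4), (3, 5), (0, 4), (1, 5)],
      ¬ K.Adj p.1 p.2 := by
    intro p hp h
    simp only [List.forall_mem_cons] at hE
    simp only [List.mem_cons, List.not_mem_nil, or_false] at hp
    obtain ⟨h1, h2, h3, h4, h5, h6, -⟩ := hE
    rcases hp with rfl | rfl | rfl | rfl | rfl | rfl
    · exact htriK _ _ _ h1 h2 h
    · exact htriK _ _ _ h2 h3 h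
    · exact htriK _ _ _ h3 h4 h
    · exact htriK _ _ _ h4 h5 h
    · exact htriK _ _ _ h5 h6 h.symm
    · exact htriK _ _ _ h6 h1 h.symm
  have hX : ∀ u v : Fin 6, u < v →
      (u, v) ∈ [((0 : Fin 6), (1 : Fin 6)), (1, 2), (2, 3), (3, 4), (4, 5), (5, 0)] ∨
      (v, u) ∈ [((0 : Fin 6), (1 : Fin 6)), (1, 2), (2, 3), (3, 4), (4, 5), (5, 0)] ∨
      (u, v) ∈ [((0 : Fin 6), (3 : Fin 6)), (1, 4), (2, 5)] ∨
      (u, v) ∈ [((0 : Fin 6), (2 : Fin 6)), (1, 3), (2, 4), (3, 5), (0, 4), (1, 5)] := by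
    decide
  obtain ⟨l, hl, rfl⟩ := exists_eq_graphOfEdges _ [((0 : Fin 6), (3 : Fin 6)), (1, 4), (2, 5)] hE
    (fun u v huv h => by
      rcases hX u v huv with h1 | h1 | h1 | h1
      · exact Or.inl h1
      · exact Or.inr (Or.inl h1)
      · exact Or.inr (Or.inr h1)
      · exact absurd h (hZ _ h1))
  have key : ∀ l ∈ [((0 : Fin 6), (3 : Fin 6)), (1, 4), (2, 5)].sublists,
      (∀ a b, (graphOfEdges 6 ([(0, 1), (1, 2), (2, 3), (3, 4), (4, 5), (5, 0)] ++ l)).Adj a b ↔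
        (SimpleGraph.cycleGraph 6).Adj a b) ∨
      ∃ L ∈ ([[(0, 1), (1, 2), (2, 3), (3, 4), (4, 5), (5, 0), (0, 3)],
          [(0, 1), (1, 2), (2, 3), (3, 4), (4, 5), (5, 0), (0, 3), (1, 4)],
          [(0, 1), (1, 2), (2, 3), (3, 4), (4, 5), (5, 0), (0, 3), (1, 4), (2, 5)]] :
          List (List (Fin 6 × Fin 6))),
        ∃ σ ∈ ([![0, 1, 2, 3, 4, 5], ![1, 2, 3, 4, 5, 0], ![2, 3, 4, 5, 0, 1]] :
          List (Fin 6 → Fin 6)), Function.Injective σ ∧ ∀ a b, (graphOfEdges 6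
            ([(0, 1), (1, 2), (2, 3), (3, 4), (4, 5), (5, 0)] ++ l)).Adj (σ a) (σ b) ↔
            (graphOfEdges 6 L).Adj a b := by
    decide +kernel
  rcases key l hl with h | ⟨L, hL, σ, -, hσ, h⟩
  · exact Or.inr (Or.inr (Or.inr (Or.inr (Or.inl ⟨6, by decide, by decide,
      nonempty_iso_of_perm id Function.injective_id h⟩))))
  · have hiso := nonempty_iso_of_perm σ hσ h
    simp only [List.mem_cons, List.not_mem_nil, or_false] at hL
    rcases hL with rfl | rfl | rfl
    all_goals exact Or.inr (Or.inr (Or.inr (Or.inl ⟨_, by simp [familyC6], hiso⟩)))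

end Classification

/-! ### Chords of bad cycles, forked paths and geodesics -/

section Structure

variable {V : Type*} {G : SimpleGraph V}

theorem exists_top_four_hom {a b c d : V} (hab : G.Adj a b) (hac : G.Adj a c) (had : G.Adj a d)
    (hbc : G.Adj b c) (hbd : G.Adj b d) (hcd : G.Adj c d) :
    ∃ φ : Fin 4 → V, Function.Injective φ ∧
      ∀ i j, (⊤ : SimpleGraph (Fin 4)).Adj i j → G.Adj (φ i) (φ j) := by
  refine ⟨![a, b, c, d], List.nodup_ofFn.1 ?_, ?_⟩
  · simp [hab.ne, hac.ne, had.ne, hbc.ne, hbd.ne, hcd.ne]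
  · intro i j hij
    fin_cases i <;> fin_cases j <;> simp_all [G.adj_comm]

theorem exists_graphH3_hom {v0 v1 v2 v3 v4 v5 : V} (h : [v0, v1, v2, v3, v4, v5].Nodup)
    (h1 : G.Adj v0 v1) (h2 : G.Adj v1 v2) (h3 : G.Adj v2 v0) (h4 : G.Adj v0 v3)
    (h5 : G.Adj v1 v4) (h6 : G.Adj v2 v5) : ∃ φ : Fin 6 → V, Function.Injective φ ∧
      ∀ i j, graphH3.Adj i j → G.Adj (φ i) (φ j) :=
  ⟨![v0, v1, v2, v3, v4, v5], List.nodup_ofFn.1 (by simpa using h),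
    adj_of_graphOfEdges_adj (by simp [h1, h2, h3, h4, h5, h6])⟩

theorem exists_graphH4_hom {v0 v1 v2 v3 v4 : V} (h : [v0, v1, v2, v3, v4].Nodup)
    (h1 : G.Adj v0 v1) (h2 : G.Adj v1 v2) (h3 : G.Adj v2 v0) (h4 : G.Adj v1 v3)
    (h5 : G.Adj v3 v4) : ∃ φ : Fin 5 → V, Function.Injective φ ∧
      ∀ i j, graphH4.Adj i j → G.Adj (φ i) (φ j) :=
  ⟨![v0, v1, v2, v3, v4], List.nodup_ofFn.1 (by simpa using h),
    adj_of_graphOfEdges_adj (by simp [h1, h2, h3, h4, h5])⟩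

theorem exists_graphH5_hom {v0 v1 v2 v3 v4 v5 : V} (h : [v0, v1, v2, v3, v4, v5].Nodup)
    (h1 : G.Adj v0 v1) (h2 : G.Adj v1 v2) (h3 : G.Adj v2 v3) (h4 : G.Adj v3 v0)
    (h5 : G.Adj v2 v4) (h6 : G.Adj v1 v5) : ∃ φ : Fin 6 → V, Function.Injective φ ∧
      ∀ i j, graphH5.Adj i j → G.Adj (φ i) (φ j) :=
  ⟨![v0, v1, v2, v3, v4, v5], List.nodup_ofFn.1 (by simpa using h),
    adj_of_graphOfEdges_adj (by simp [h1, h2, h3, h4, h5, h6])⟩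

theorem exists_graphH14_hom {v0 v1 v2 v3 v4 v5 v6 : V} (h : [v0, v1, v2, v3, v4, v5, v6].Nodup)
    (h1 : G.Adj v0 v1) (h2 : G.Adj v1 v2) (h3 : G.Adj v2 v3) (h4 : G.Adj v3 v4)
    (h5 : G.Adj v2 v5) (h6 : G.Adj v3 v6) : ∃ φ : Fin 7 → V, Function.Injective φ ∧
      ∀ i j, graphH14.Adj i j → G.Adj (φ i) (φ j) :=
  ⟨![v0, v1, v2, v3, v4, v5, v6], List.nodup_ofFn.1 (by simpa using h),
    adj_of_graphOfEdges_adj (by simp [h1, h2, h3, h4, h5, h6])⟩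

/-- The first `n` terms of `f` are the consecutive vertices of a cycle. -/
structure IsCycleSeq (G : SimpleGraph V) (n : ℕ) (f : ℕ → V) : Prop where
  inj : ∀ i j, i < j → j < n → f i ≠ f j
  adj : ∀ i, i + 1 < n → G.Adj (f i) (f (i + 1))
  close : G.Adj (f (n - 1)) (f 0)

namespace IsCycleSeq

variable {n : ℕ} {f : ℕ → V}

theorem inj' (h : IsCycleSeq G n f) {i j : ℕ} (hi : i < n) (hj : j < n) (hij : i ≠ j) :
    f i ≠ f j := by
  rcases lt_or_gt_of_ne hij with h' | h'
  · exact h.inj i j h' hj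
  · exact (h.inj j i h' hi).symm

theorem adj_mod (h : IsCycleSeq G n f) (hn : 0 < n) (m : ℕ) :
    G.Adj (f (m % n)) (f ((m + 1) % n)) := by
  have hm := Nat.mod_lt m hn
  rw [Nat.add_mod]
  by_cases h' : m % n + 1 < n
  · rw [Nat.mod_eq_of_lt (show 1 < n by omega), Nat.mod_eq_of_lt h']
    exact h.adj _ h'
  · by_cases hn1 : n = 1
    · subst hn1
      exact absurd rfl h.close.ne
    · rw [Nat.mod_eq_of_lt (show 1 < n by omega), show m % n + 1 = n by omega, Nat.mod_self,
        show m % n = n - 1 by omega]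
      exact h.close

/-- Allows every chord to be treated as starting at `f 0`. -/
theorem rotate (h : IsCycleSeq G n f) (hn : 0 < n) (i : ℕ) :
    IsCycleSeq G n (fun m => f ((i + m) % n)) where
  inj a b hab hb := by
    refine h.inj' (Nat.mod_lt _ hn) (Nat.mod_lt _ hn) fun h' => ?_
    have h2 : a % n = b % n := Nat.ModEq.add_left_cancel' i h'
    rw [Nat.mod_eq_of_lt hb, Nat.mod_eq_of_lt (hab.trans hb)] at h2
    omega
  adj a _ := h.adj_mod hn (i + a)
  close := by
    have := h.adj_mod hn (i + (n - 1))
    rwa [show i + (n - 1) + 1 = i + 0 + n by omega, Nat.add_mod_right] at this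

theorem hom_adj (h : IsCycleSeq G n f) (hn : 3 ≤ n) (a b : Fin n)
    (hab : (SimpleGraph.cycleGraph n).Adj a b) : G.Adj (f a) (f b) := by
  have ha := a.2
  have hb := b.2
  rcases (cycleGraph_adj_iff_val hn).1 hab with h' | h' | ⟨h1, h2⟩ | ⟨h1, h2⟩
  · rw [← h']
    exact h.adj _ (by omega)
  · rw [← h']
    exact (h.adj _ (by omega)).symm
  · rw [h1, show (b : ℕ) = n - 1 by omega]
    exact h.close.symm
  · rw [h1, show (a : ℕ) = n - 1 by omega]
    exact h.close

theorem injective (h : IsCycleSeq G n f) : Function.Injective fun a : Fin n => f a := by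
  intro a b hab
  by_contra hne
  exact h.inj' a.2 b.2 (fun h => hne (Fin.ext h)) hab

theorem natCard_eq (h : IsCycleSeq G n f) (hG : IsPackingCritical G) (hn : 5 ≤ n)
    (hn4 : n % 4 ≠ 0) : Nat.card V = n := by
  simpa using hG.natCard_eq (not_packable_cycleGraph hn hn4) h.injective (h.hom_adj (by omega))

/-- The chord closes a cycle of order `t + 1 < n`. Unless that order is divisible by four, it is a
triangle or a nonpackable proper subgraph. -/
theorem mod_four_of_chord (h : IsCycleSeq G n f) (hG : IsPackingCritical G)
    (htri : TriangleFree G) (hcard : Nat.card V = n) {t : ℕ} (ht : 2 ≤ t) (htn : t + 2 ≤ n)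
    (hadj : G.Adj (f 0) (f t)) : (t + 1) % 4 = 0 := by
  by_contra h4
  by_cases h2 : t = 2
  · subst h2
    exact htri _ _ _ (h.adj 0 (by omega)) (h.adj 1 (by omega)) hadj
  · have h' : IsCycleSeq G (t + 1) f := ⟨fun i j hij hj => h.inj i j hij (by omega),
      fun i hi => h.adj i (by omega), hadj.symm⟩
    have := h'.natCard_eq hG (by omega) h4
    omega

/-- The chord serves as the middle edge of a copy of `graphH14` made of cycle vertices. That copy
has seven vertices, fewer than `n`. -/
theorem not_adj_of_seven_le (h : IsCycleSeq G n f) (hG : IsPackingCritical G)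
    (hcard : Nat.card V = n) {t : ℕ} (ht : 7 ≤ t) (htn : t + 3 ≤ n) : ¬ G.Adj (f 0) (f t) := by
  intro hadj
  have e : t - 1 + 1 = t := by omega
  obtain ⟨φ, hφ, hφadj⟩ := exists_graphH14_hom (G := G) (v0 := f 2) (v1 := f 1) (v2 := f 0)
    (v3 := f t) (v4 := f (t - 1)) (v5 := f (n - 1)) (v6 := f (t + 1))
    (by
      have := fun i j hi hj hij => h.inj' (i := i) (j := j) hi hj hij
      simp only [List.nodup_cons, List.mem_cons, List.not_mem_nil, or_false, not_or,
        not_false_eq_true, List.nodup_nil, and_true]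
      refine ⟨⟨?_, ?_, ?_, ?_, ?_, ?_⟩, ⟨?_, ?_, ?_, ?_, ?_⟩, ⟨?_, ?_, ?_, ?_⟩, ⟨?_, ?_, ?_⟩,
        ⟨?_, ?_⟩, ?_⟩ <;> exact this _ _ (by omega) (by omega) (by omega))
    (h.adj 1 (by omega)).symm (h.adj 0 (by omega)).symm hadj
    (by simpa [e] using (h.adj (t - 1) (by omega)).symm) h.close.symm (h.adj t (by omega))
  have := hG.natCard_eq not_packable_graphH14 hφ hφadj
  simp at this
  omega

/-- Both cycles cut off by a chord have order divisible by four. If both had order four then `n =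
6`, so one has order at least eight and the preceding exclusion applies from the appropriate end. -/
theorem not_chord (h : IsCycleSeq G n f) (hG : IsPackingCritical G)
    (htri : TriangleFree G) (hcard : Nat.card V = n) (hn6 : n ≠ 6) {t : ℕ} (ht : 2 ≤ t)
    (htn : t + 2 ≤ n) : ¬ G.Adj (f 0) (f t) := by
  intro hadj
  have h1 := h.mod_four_of_chord hG htri hcard ht htn hadj
  have hr := h.rotate (by omega) t
  have hadj' : G.Adj (f ((t + 0) % n)) (f ((t + (n - t)) % n)) := by
    rw [show t + (n - t) = n by omega, Nat.mod_self, Nat.add_zero, Nat.mod_eq_of_lt (by omega)]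
    exact hadj.symm
  have h2 := hr.mod_four_of_chord hG htri hcard (t := n - t) (by omega) (by omega) hadj'
  by_cases h7 : 7 ≤ t
  · exact h.not_adj_of_seven_le hG hcard h7 (by omega) hadj
  · exact hr.not_adj_of_seven_le hG hcard (t := n - t) (by omega) (by omega) hadj'

end IsCycleSeq

theorem isListed_of_hasBadCycle (hG : IsPackingCritical G) (htri : TriangleFree G)
    (h : HasBadCycle G) : IsListed G := by
  obtain ⟨n, f, hn, hn4, h1, h2, h3⟩ := h
  have h : IsCycleSeq G n f := ⟨h1, h2, h3⟩
  by_cases hn6 : n = 6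
  · subst hn6
    exact isListed_of_cycleGraph_six_hom hG htri h.injective (h.hom_adj (by decide))
  have hcard := h.natCard_eq hG hn hn4
  have hsurj := hG.surjective (not_packable_cycleGraph hn hn4) h.injective (h.hom_adj (by omega))
  refine Or.inr (Or.inr (Or.inr (Or.inr (Or.inl ⟨n, hn, hn4,
    nonempty_iso_of_comap ⟨h.injective, hsurj⟩ fun a b => ⟨fun hab => ?_, h.hom_adj (by omega) a b⟩⟩))))
  have key : ∀ a b : Fin n, a < b → G.Adj (f a) (f b) →
      (SimpleGraph.cycleGraph n).Adj a b := by
    intro a b hlt hab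
    have hlt' : a.val < b.val := hlt
    have hb := b.2
    rw [cycleGraph_adj_iff_val (by omega)]
    by_contra hne
    refine (h.rotate (by omega) a).not_chord hG htri hcard hn6 (t := b - a) (by omega) (by omega) ?_
    rw [Nat.add_zero, Nat.mod_eq_of_lt a.2, show (a : ℕ) + (b - a) = b by omega,
      Nat.mod_eq_of_lt hb]
    exact hab
  have hne : a ≠ b := by
    rintro rfl
    exact hab.ne rfl
  rcases lt_or_gt_of_ne hne with h' | h'
  · exact key a b h' hab
  · exact (key b a h' hab.symm).symm

/-- The first `2 * k` terms of `f` are the vertices of a path, and `a` and `b` are further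
neighbors of its support vertices. -/
structure IsForkedPath (G : SimpleGraph V) (k : ℕ) (f : ℕ → V) (a b : V) : Prop where
  inj : ∀ i j, i < j → j < 2 * k → f i ≠ f j
  ne_left : ∀ i, i < 2 * k → f i ≠ a
  ne_right : ∀ i, i < 2 * k → f i ≠ b
  ne : a ≠ b
  adj : ∀ i, i + 1 < 2 * k → G.Adj (f i) (f (i + 1))
  adj_left : G.Adj (f 1) a
  adj_right : G.Adj (f (2 * k - 2)) b

namespace IsForkedPath

variable {k : ℕ} {f : ℕ → V} {a b : V}

/-- The map from the vertices of `G_{2k}` given by a forked path. -/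
def toFun (k : ℕ) (f : ℕ → V) (a b : V) : Fin (2 * k) ⊕ Bool → V
  | Sum.inl i => f i
  | Sum.inr false => a
  | Sum.inr true => b

theorem injective (h : IsForkedPath G k f a b) : Function.Injective (toFun k f a b) := by
  rintro (i | (_ | _)) (j | (_ | _)) hij <;> simp only [toFun] at hij
  · by_contra hne
    have hne' : i.val ≠ j.val := fun h => hne (congrArg _ (Fin.ext h))
    rcases lt_or_gt_of_ne hne' with h' | h'
    · exact h.inj _ _ h' j.2 hij
    · exact h.inj _ _ h' i.2 hij.symm
  · exact absurd hij (h.ne_left _ i.2)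
  · exact absurd hij (h.ne_right _ i.2)
  · exact absurd hij.symm (h.ne_left _ j.2)
  · rfl
  · exact absurd hij h.ne
  · exact absurd hij.symm (h.ne_right _ j.2)
  · exact absurd hij.symm h.ne
  · rfl

theorem hom_adj (h : IsForkedPath G k f a b) (u v : Fin (2 * k) ⊕ Bool)
    (huv : (graphG k).Adj u v) : G.Adj (toFun k f a b u) (toFun k f a b v) := by
  have key1 : ∀ i : Fin (2 * k), (graphG k).Adj (Sum.inl i) (Sum.inr false) → G.Adj (f i) a := by
    intro i hi
    rw [graphG_adj_inl_false.1 hi]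
    exact h.adj_left
  have key2 : ∀ i : Fin (2 * k), (graphG k).Adj (Sum.inl i) (Sum.inr true) → G.Adj (f i) b := by
    intro i hi
    rw [show (i : ℕ) = 2 * k - 2 by have := graphG_adj_inl_true.1 hi; omega]
    exact h.adj_right
  rcases u with i | (_ | _) <;> rcases v with j | (_ | _) <;> simp only [toFun]
  · rcases graphG_adj_inl_inl.1 huv with h' | h'
    · rw [← h']
      exact h.adj _ (by omega)
    · rw [← h']
      exact (h.adj _ (by omega)).symm
  · exact key1 i huv
  · exact key2 i huv
  · exact (key1 j huv.symm).symm
  · exact absurd huv not_graphG_adj_inr_inr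
  · exact absurd huv not_graphG_adj_inr_inr
  · exact (key2 j huv.symm).symm
  · exact absurd huv not_graphG_adj_inr_inr
  · exact absurd huv not_graphG_adj_inr_inr

theorem natCard_eq (h : IsForkedPath G k f a b) (hG : IsPackingCritical G) (hk : 3 ≤ k) :
    Nat.card V = 2 * k + 2 := by
  simpa using hG.natCard_eq (not_packable_graphG hk) h.injective h.hom_adj

theorem isListed (h : IsForkedPath G k f a b) (hG : IsPackingCritical G) (hk : 3 ≤ k)
    (hpath : ∀ i j, i < j → j < 2 * k → G.Adj (f i) (f j) → i + 1 = j)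
    (hleft : ∀ i, i < 2 * k → G.Adj (f i) a → i = 1)
    (hright : ∀ i, i < 2 * k → G.Adj (f i) b → i + 2 = 2 * k)
    (hab : ¬ G.Adj a b) : IsListed G := by
  have hsurj := hG.surjective (not_packable_graphG hk) h.injective h.hom_adj
  refine Or.inr (Or.inr (Or.inr (Or.inr (Or.inr ⟨k, hk,
    nonempty_iso_of_comap ⟨h.injective, hsurj⟩ fun u v => ⟨fun huv => ?_, h.hom_adj u v⟩⟩))))
  rcases u with i | (_ | _) <;> rcases v with j | (_ | _) <;> simp only [toFun] at huv
  · rw [graphG_adj_inl_inl]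
    rcases lt_trichotomy i.val j.val with h' | h' | h'
    · exact Or.inl (hpath _ _ h' j.2 huv)
    · exact absurd (congrArg f h') huv.ne
    · exact Or.inr (hpath _ _ h' i.2 huv.symm)
  · exact graphG_adj_inl_false.2 (hleft _ i.2 huv)
  · exact graphG_adj_inl_true.2 (hright _ i.2 huv)
  · exact (graphG_adj_inl_false.2 (hleft _ j.2 huv.symm)).symm
  · exact absurd rfl huv.ne
  · exact absurd huv hab
  · exact (graphG_adj_inl_true.2 (hright _ j.2 huv.symm)).symm
  · exact absurd huv.symm hab
  · exact absurd rfl huv.ne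

end IsForkedPath

/-- The first `d + 1` terms of `p` are the vertices of a shortest path. -/
structure IsGeodesic (G : SimpleGraph V) (d : ℕ) (p : ℕ → V) : Prop where
  adj : ∀ i, i < d → G.Adj (p i) (p (i + 1))
  dist_eq : ∀ i, i ≤ d → G.dist (p 0) (p i) = i

namespace IsGeodesic

variable {d : ℕ} {p : ℕ → V}

/-- Walking backwards bounds the distances from above, and the triangle inequality against the full
length bounds them from below. -/
theorem reverse (h : IsGeodesic G d p) (hG : G.Connected) :
    IsGeodesic G d (fun i => p (d - i)) where
  adj i hi := by
    have := h.adj (d - (i + 1)) (by omega)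
    rw [show d - (i + 1) + 1 = d - i by omega] at this
    exact this.symm
  dist_eq i hi := by
    have key : ∀ i, i ≤ d → G.dist (p (d - 0)) (p (d - i)) ≤ i := by
      intro i
      induction i with
      | zero => simp
      | succ i ih =>
        intro hi
        have h1 := ih (by omega)
        have h2 := h.adj (d - (i + 1)) (by omega)
        rw [show d - (i + 1) + 1 = d - i by omega] at h2
        have h3 := dist_le_dist_add_one_of_adj hG (p (d - 0)) h2.symm
        omega
    have h1 := key i hi
    have h2 := h.dist_eq (d - i) (by omega)
    have h3 := h.dist_eq d le_rfl
    have h4 := hG.dist_triangle (u := p 0) (v := p (d - i)) (w := p d)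
    rw [SimpleGraph.dist_comm (u := p (d - i))] at h4
    simp only [Nat.sub_zero] at *
    omega

theorem inj (h : IsGeodesic G d p) {i j : ℕ} (hij : i < j) (hj : j ≤ d) : p i ≠ p j := by
  intro h'
  have h1 := h.dist_eq i (by omega)
  have h2 := h.dist_eq j hj
  rw [h'] at h1
  omega

theorem drop (h : IsGeodesic G d p) (hG : G.Connected) (m : ℕ) (hm : m ≤ d) :
    G.dist (p m) (p d) = d - m := by
  have := (h.reverse hG).dist_eq (d - m) (by omega)
  simp only [Nat.sub_zero] at this
  rw [show d - (d - m) = m by omega] at this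
  rw [SimpleGraph.dist_comm, this]

end IsGeodesic

theorem exists_isGeodesic (hG : G.Connected) (x y : V) :
    ∃ p : ℕ → V, p 0 = x ∧ p (G.dist x y) = y ∧ IsGeodesic G (G.dist x y) p := by
  obtain ⟨p, h1, h2, h3, h4⟩ := exists_geodesic hG x y
  exact ⟨p, h1, h2, h3, fun i hi => by rw [h1]; exact h4 i hi⟩

end Structure

/-! ### Locating a listed graph in every critical graph -/

section Branching

variable {V : Type*} {G : SimpleGraph V}

namespace IsGeodesic

variable {d : ℕ} {p : ℕ → V} {z w : V}

theorem ne_left (h : IsGeodesic G d p) (hz : G.Adj (p 0) z) (hz1 : z ≠ p 1) {j : ℕ} (hj : j ≤ d) :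
    p j ≠ z := by
  rintro rfl
  have h1 := h.dist_eq j hj
  rw [SimpleGraph.dist_eq_one_iff_adj.2 hz] at h1
  exact hz1 (by rw [h1])

theorem ne_right (h : IsGeodesic G d p) (hG : G.Connected) (hz : G.Adj (p d) z)
    (hz1 : z ≠ p (d - 1)) {j : ℕ} (hj : j ≤ d) : p j ≠ z := by
  have := (h.reverse hG).ne_left hz hz1 (j := d - j) (by omega)
  rwa [show d - (d - j) = j by omega] at this

theorem dist_left (hz : G.Adj (p 0) z) : G.dist (p 0) z = 1 :=
  SimpleGraph.dist_eq_one_iff_adj.2 hz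

theorem le_dist_right (h : IsGeodesic G d p) (hG : G.Connected) (hw : G.Adj (p d) w) :
    d ≤ G.dist (p 0) w + 1 := by
  have := dist_le_dist_add_one_of_adj hG (p 0) hw.symm
  rwa [h.dist_eq d le_rfl] at this

theorem left_ne_right (h : IsGeodesic G d p) (hG : G.Connected) (hd : 3 ≤ d)
    (hz : G.Adj (p 0) z) (hw : G.Adj (p d) w) : z ≠ w := by
  rintro rfl
  have h1 := dist_left hz
  have h2 := h.le_dist_right hG hw
  omega

theorem eq_of_adj_left (h : IsGeodesic G d p) (hG : G.Connected) (htri : TriangleFree G)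
    (hcyc : ¬ HasBadCycle G) (hz : G.Adj (p 0) z) {j : ℕ} (hj : j ≤ d) (hadj : G.Adj (p j) z) :
    j = 0 ∨ j = 2 := by
  have h1 := dist_left hz
  have h2 := h.dist_eq j hj
  have h3 := dist_eq_add_one_of_adj hG htri hcyc (p 0) hadj
  omega

/-- A path with one more vertex on each side. -/
def extend (d : ℕ) (p : ℕ → V) (x y : V) (i : ℕ) : V :=
  if i = 0 then x else if i ≤ d + 1 then p (i - 1) else y

theorem extend_succ {x y : V} {i : ℕ} (hi : i ≤ d) : extend d p x y (i + 1) = p i := by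
  simp [extend, hi]

theorem extend_last {x y : V} : extend d p x y (d + 2) = y := by
  simp [extend]

theorem extend_cases (x y : V) {i : ℕ} (hi : i < d + 3) : (i = 0 ∧ extend d p x y i = x) ∨
    (∃ j, j ≤ d ∧ i = j + 1 ∧ extend d p x y i = p j) ∨ (i = d + 2 ∧ extend d p x y i = y) := by
  rcases i with _ | i
  · exact Or.inl ⟨rfl, rfl⟩
  · rcases Nat.lt_or_ge d i with h | h
    · obtain rfl : i = d + 1 := by omega
      exact Or.inr (Or.inr ⟨rfl, extend_last⟩)
    · exact Or.inr (Or.inl ⟨i, h, rfl, extend_succ h⟩)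

/-- One spare neighbor at each end lengthens the geodesic from `d + 1` to `d + 3` vertices, and the
other becomes the pendant vertex. Since `d` is at least three, the two ends do not interfere. -/
theorem isForkedPath (h : IsGeodesic G d p) (hG : G.Connected) (hd : 3 ≤ d) {k : ℕ}
    (hk : 2 * k = d + 3) {x₁ x₂ y₁ y₂ : V} (hx₁ : G.Adj (p 0) x₁) (hx₂ : G.Adj (p 0) x₂)
    (hx : x₁ ≠ x₂) (hx₁p : x₁ ≠ p 1) (hx₂p : x₂ ≠ p 1) (hy₁ : G.Adj (p d) y₁)
    (hy₂ : G.Adj (p d) y₂) (hy : y₁ ≠ y₂) (hy₁p : y₁ ≠ p (d - 1)) (hy₂p : y₂ ≠ p (d - 1)) :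
    IsForkedPath G k (extend d p x₁ y₁) x₂ y₂ where
  inj i j hij hj := by
    rcases extend_cases (p := p) x₁ y₁ (show i < d + 3 by omega) with ⟨hi, e⟩ | ⟨i', hi, hi', e⟩ | ⟨hi, e⟩ <;>
      rcases extend_cases (p := p) x₁ y₁ (show j < d + 3 by omega) with
        ⟨hj, e'⟩ | ⟨j', hj, hj', e'⟩ | ⟨hj, e'⟩ <;> rw [e, e'] <;> try omega
    · exact (h.ne_left hx₁ hx₁p hj).symm
    · exact h.left_ne_right hG hd hx₁ hy₁
    · exact h.inj (by omega) hj
    · exact h.ne_right hG hy₁ hy₁p hi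
  ne_left i hi := by
    rcases extend_cases (p := p) x₁ y₁ (show i < d + 3 by omega) with ⟨hi, e⟩ | ⟨i', hi, hi', e⟩ | ⟨hi, e⟩ <;>
      rw [e]
    · exact hx
    · exact h.ne_left hx₂ hx₂p hi
    · exact (h.left_ne_right hG hd hx₂ hy₁).symm
  ne_right i hi := by
    rcases extend_cases (p := p) x₁ y₁ (show i < d + 3 by omega) with ⟨hi, e⟩ | ⟨i', hi, hi', e⟩ | ⟨hi, e⟩ <;>
      rw [e]
    · exact h.left_ne_right hG hd hx₁ hy₂
    · exact h.ne_right hG hy₂ hy₂p hi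
    · exact hy
  ne := h.left_ne_right hG hd hx₂ hy₂
  adj i hi := by
    rcases i with _ | i
    · rw [extend_succ (Nat.zero_le d)]
      exact hx₁.symm
    · rcases Nat.lt_or_ge i d with h' | h'
      · rw [extend_succ h'.le, extend_succ h']
        exact h.adj i h'
      · obtain rfl : i = d := by omega
        rw [extend_succ le_rfl, extend_last]
        exact hy₁
  adj_left := by
    rw [extend_succ (Nat.zero_le d)]
    exact hx₂
  adj_right := by
    rw [show 2 * k - 2 = d + 1 by omega, extend_succ le_rfl]
    exact hy₂

theorem natCard_eq (h : IsGeodesic G d p) (hG : IsPackingCritical G) (hd : 3 ≤ d)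
    (hodd : d % 2 = 1) (hx : HasThreeNeighbors G (p 0)) (hy : HasThreeNeighbors G (p d)) :
    Nat.card V = d + 5 := by
  obtain ⟨x₁, x₂, hx₁, hx₂, hx, hx₁p, hx₂p⟩ := hx.exists_two (p 1)
  obtain ⟨y₁, y₂, hy₁, hy₂, hy, hy₁p, hy₂p⟩ := hy.exists_two (p (d - 1))
  have := (h.isForkedPath hG.connected hd (k := (d + 3) / 2) (by omega) hx₁ hx₂ hx hx₁p hx₂p hy₁
    hy₂ hy hy₁p hy₂p).natCard_eq hG (by omega)
  omega

/-- Such an edge would give `p 2` three neighbors. For `d ≥ 5` the geodesic from `p 2` then carries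
a smaller forked path. For `d = 3` the edge from `p 2` to `p 3` is the middle of a copy of
`graphH14`, on seven of the eight vertices. -/
theorem not_adj_two (h : IsGeodesic G d p) (hG : IsPackingCritical G) (hd : 3 ≤ d)
    (hodd : d % 2 = 1) (hx : HasThreeNeighbors G (p 0)) (hy : HasThreeNeighbors G (p d))
    (hz : G.Adj (p 0) z) (hz1 : z ≠ p 1) : ¬ G.Adj (p 2) z := by
  intro hadj
  have hcard := h.natCard_eq hG hd hodd hx hy
  by_cases h5 : 5 ≤ d
  · have h' : IsGeodesic G (d - 2) (fun i => p (2 + i)) := by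
      refine ⟨fun i hi => h.adj (2 + i) (by omega), fun i hi => ?_⟩
      have hg : IsGeodesic G (2 + i) p := ⟨fun j hj => h.adj j (by omega),
        fun j hj => h.dist_eq j (by omega)⟩
      have := hg.drop hG.connected 2 (by omega)
      rw [Nat.add_zero, this]
      omega
    have h3 : HasThreeNeighbors G (p (2 + 0)) := ⟨p 1, p 3, z, (h.adj 1 (by omega)).symm,
      h.adj 2 (by omega), hadj, h.inj (by omega) (by omega), hz1.symm,
      h.ne_left hz hz1 (by omega)⟩
    have := h'.natCard_eq hG (by omega) (by omega) h3
      (by rwa [show 2 + (d - 2) = d by omega])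
    omega
  · obtain rfl : d = 3 := by omega
    obtain ⟨y₁, y₂, hy₁, hy₂, hy, hy₁p, hy₂p⟩ := hy.exists_two (p (3 - 1))
    have hc := hG.connected
    have a1 := fun j (hj : j ≤ 3) => h.ne_left hz hz1 hj
    have a2 := fun j (hj : j ≤ 3) => h.ne_right hc hy₁ hy₁p hj
    have a3 := fun j (hj : j ≤ 3) => h.ne_right hc hy₂ hy₂p hj
    have a4 := h.left_ne_right hc le_rfl hz hy₁
    have a5 := h.left_ne_right hc le_rfl hz hy₂
    obtain ⟨φ, hφ, hφadj⟩ := exists_graphH14_hom (G := G) (v0 := p 0) (v1 := p 1) (v2 := p 2)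
      (v3 := p 3) (v4 := y₁) (v5 := z) (v6 := y₂)
      (by
        simp only [List.nodup_cons, List.mem_cons, List.not_mem_nil, or_false, not_or,
          not_false_eq_true, List.nodup_nil, and_true]
        exact ⟨⟨h.inj (by omega) (by omega), h.inj (by omega) (by omega),
          h.inj (by omega) (by omega), a2 0 (by omega), a1 0 (by omega), a3 0 (by omega)⟩,
          ⟨h.inj (by omega) (by omega), h.inj (by omega) (by omega), a2 1 (by omega),
            a1 1 (by omega), a3 1 (by omega)⟩,
          ⟨h.inj (by omega) (by omega), a2 2 (by omega), a1 2 (by omega), a3 2 (by omega)⟩,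
          ⟨a2 3 (by omega), a1 3 (by omega), a3 3 (by omega)⟩, ⟨a4.symm, hy⟩, a5⟩)
      (h.adj 0 (by omega)) (h.adj 1 (by omega)) (h.adj 2 (by omega)) hy₁ hadj hy₂
    have := hG.natCard_eq not_packable_graphH14 hφ hφadj
    simp at this
    omega

theorem isListed (h : IsGeodesic G d p) (hG : IsPackingCritical G) (htri : TriangleFree G)
    (hcyc : ¬ HasBadCycle G) (hd : 3 ≤ d) (hodd : d % 2 = 1) (hx : HasThreeNeighbors G (p 0))
    (hy : HasThreeNeighbors G (p d)) : IsListed G := by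
  have hc := hG.connected
  have hr := h.reverse hc
  have left : ∀ z, G.Adj (p 0) z → z ≠ p 1 → ∀ j, j ≤ d → G.Adj (p j) z → j = 0 := by
    intro z hz hz1 j hj hadj
    rcases h.eq_of_adj_left hc htri hcyc hz hj hadj with rfl | rfl
    · rfl
    · exact absurd hadj (h.not_adj_two hG hd hodd hx hy hz hz1)
  have right : ∀ z, G.Adj (p d) z → z ≠ p (d - 1) → ∀ j, j ≤ d → G.Adj (p j) z → j = d := by
    intro z hz hz1 j hj hadj
    have hadj' : G.Adj (p (d - (d - j))) z := by rwa [show d - (d - j) = j by omega]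
    rcases hr.eq_of_adj_left hc htri hcyc hz (j := d - j) (by omega) hadj' with h' | h'
    · omega
    · rw [h'] at hadj'
      exact absurd hadj' (hr.not_adj_two hG hd hodd hy (by rwa [Nat.sub_self]) hz hz1)
  -- Levels force `d = 3`, and then `z`, the geodesic and `w` form a six-cycle.
  have cross : ∀ z w, G.Adj (p 0) z → z ≠ p 1 → G.Adj (p d) w → w ≠ p (d - 1) →
      ¬ G.Adj z w := by
    intro z w hz hz1 hw hw1 hzw
    have h1 := dist_left hz
    have h2 := h.le_dist_right hc hw
    have h3 := dist_le_dist_add_one_of_adj hc (p 0) hzw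
    obtain rfl : d = 3 := by omega
    have h4 := h.left_ne_right hc hd hz hw
    have f0 : extend 3 p z w 0 = z := rfl
    have f5 : extend 3 p z w (6 - 1) = w := extend_last
    refine hcyc ⟨6, extend 3 p z w, by decide, by decide, fun i j hij hj => ?_, fun i hi => ?_, ?_⟩
    · rcases extend_cases (p := p) z w (show i < 3 + 3 by omega) with
        ⟨hi, e⟩ | ⟨i', hi, hi', e⟩ | ⟨hi, e⟩ <;>
      rcases extend_cases (p := p) z w (show j < 3 + 3 by omega) with
        ⟨hj, e'⟩ | ⟨j', hj, hj', e'⟩ | ⟨hj, e'⟩ <;> rw [e, e'] <;> try omega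
      · exact (h.ne_left hz hz1 hj).symm
      · exact h.inj (by omega) hj
      · exact h.ne_right hc hw hw1 hi
    · rcases i with _ | i
      · rw [f0, extend_succ (Nat.zero_le 3)]
        exact hz.symm
      · rcases Nat.lt_or_ge i 3 with h' | h'
        · rw [extend_succ h'.le, extend_succ h']
          exact h.adj i h'
        · obtain rfl : i = 3 := by omega
          rw [extend_succ le_rfl, extend_last]
          exact hw
    · rw [f0, f5]
      exact hzw.symm
  have noTri : ∀ v a b, G.Adj v a → G.Adj v b → ¬ G.Adj a b := fun v a b ha hb hab =>
    htri _ _ _ ha hab hb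
  obtain ⟨x₁, x₂, hx₁, hx₂, hx', hx₁p, hx₂p⟩ := hx.exists_two (p 1)
  obtain ⟨y₁, y₂, hy₁, hy₂, hy', hy₁p, hy₂p⟩ := hy.exists_two (p (d - 1))
  have hk : 2 * ((d + 3) / 2) = d + 3 := by omega
  refine (h.isForkedPath hc hd hk hx₁ hx₂ hx' hx₁p hx₂p hy₁ hy₂ hy' hy₁p hy₂p).isListed hG
    (by omega) (fun i j hij hj hadj => ?_) (fun i hi hadj => ?_) (fun i hi hadj => ?_)
    (cross _ _ hx₂ hx₂p hy₂ hy₂p)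
  · rcases extend_cases (p := p) x₁ y₁ (show i < d + 3 by omega) with
      ⟨hi, e⟩ | ⟨i', hi, hi', e⟩ | ⟨hi, e⟩ <;>
    rcases extend_cases (p := p) x₁ y₁ (show j < d + 3 by omega) with
      ⟨hj, e'⟩ | ⟨j', hj, hj', e'⟩ | ⟨hj, e'⟩ <;> rw [e, e'] at hadj <;> try omega
    · have := left _ hx₁ hx₁p j' hj hadj.symm
      omega
    · exact absurd hadj (cross _ _ hx₁ hx₁p hy₁ hy₁p)
    · have h1 := dist_le_dist_add_one_of_adj hc (p 0) hadj
      rw [h.dist_eq i' hi, h.dist_eq j' hj] at h1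
      omega
    · have := right _ hy₁ hy₁p i' hi hadj
      omega
  · rcases extend_cases (p := p) x₁ y₁ (show i < d + 3 by omega) with
      ⟨hi, e⟩ | ⟨i', hi, hi', e⟩ | ⟨hi, e⟩ <;> rw [e] at hadj
    · exact absurd hadj (noTri _ _ _ hx₁ hx₂)
    · have := left _ hx₂ hx₂p i' hi hadj
      omega
    · exact absurd hadj.symm (cross _ _ hx₂ hx₂p hy₁ hy₁p)
  · rcases extend_cases (p := p) x₁ y₁ (show i < d + 3 by omega) with
      ⟨hi, e⟩ | ⟨i', hi, hi', e⟩ | ⟨hi, e⟩ <;> rw [e] at hadj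
    · exact absurd hadj (cross _ _ hx₁ hx₁p hy₂ hy₂p)
    · have := right _ hy₂ hy₂p i' hi hadj
      omega
    · exact absurd hadj (noTri _ _ _ hy₁ hy₂)

end IsGeodesic

/-- The path `a b x y` either closes to a four-cycle, giving `graphH5` with spare neighbors of `x`
and `y`, or stays open and gives `graphH14`. -/
theorem isListed_of_adj_of_edge (hG : IsPackingCritical G) (htri : TriangleFree G)
    (hcyc : ¬ HasBadCycle G) {x y a b : V} (hxy : G.Adj x y) (hx : HasThreeNeighbors G x)
    (hy : HasThreeNeighbors G y) (hxb : G.Adj x b) (hby : b ≠ y) (hba : G.Adj b a) (hax : a ≠ x) :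
    IsListed G := by
  have hc := hG.connected
  obtain ⟨r⟩ := hG.nonempty
  have hq : ∀ u v, G.Adj u v → G.dist r u % 2 ≠ G.dist r v % 2 := by
    intro u v huv
    have := dist_eq_add_one_of_adj hc htri hcyc r huv
    omega
  have noTri : ∀ {v a b}, G.Adj v a → G.Adj v b → ¬ G.Adj a b := fun ha hb hab =>
    htri _ _ _ ha hab hb
  obtain ⟨f, hxf, hfy, hfb⟩ : ∃ f, G.Adj x f ∧ f ≠ y ∧ f ≠ b := by
    obtain ⟨f, g, hf, hg, hfg, hfy, hgy⟩ := hx.exists_two y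
    by_cases hfb : f = b
    · exact ⟨g, hg, hgy, fun h => hfg (hfb.trans h.symm)⟩
    · exact ⟨f, hf, hfy, hfb⟩
  have hay : a ≠ y := by
    rintro rfl
    exact noTri hxb hxy hba
  have haf : a ≠ f := by
    rintro rfl
    exact noTri hxb hxf hba
  have hyN : ∀ {e}, G.Adj y e → e ≠ b ∧ e ≠ f := by
    intro e he
    constructor
    · rintro rfl
      exact noTri hxy hxb he
    · rintro rfl
      exact noTri hxy hxf he
  by_cases hya : G.Adj y a
  · obtain ⟨e, hye, hex, hea⟩ : ∃ e, G.Adj y e ∧ e ≠ x ∧ e ≠ a := by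
      obtain ⟨e, g, he, hg, heg, hex, hgx⟩ := hy.exists_two x
      by_cases hea : e = a
      · exact ⟨g, hg, hgx, fun h => heg (hea.trans h.symm)⟩
      · exact ⟨e, he, hex, hea⟩
    obtain ⟨φ, hφ, hφadj⟩ := exists_graphH5_hom (G := G) (v0 := b) (v1 := x) (v2 := y) (v3 := a)
      (v4 := e) (v5 := f)
      (by
        simp only [List.nodup_cons, List.mem_cons, List.not_mem_nil, or_false, not_or,
          not_false_eq_true, List.nodup_nil, and_true]
        exact ⟨⟨hxb.ne', hby, hba.ne, (hyN hye).1.symm, hfb.symm⟩,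
          ⟨hxy.ne, hax.symm, hex.symm, hxf.ne⟩, ⟨hay.symm, hye.ne, hfy.symm⟩, ⟨hea.symm, haf⟩,
          (hyN hye).2⟩)
      hxb.symm hxy hya hba.symm hye hxf
    exact isListed_of_graphH5_hom hG hcyc hq hφ hφadj
  · obtain ⟨e, g, he, hg, heg, hex, hgx⟩ := hy.exists_two x
    have hea : a ≠ e := fun h => hya (h ▸ he)
    have hga : a ≠ g := fun h => hya (h ▸ hg)
    obtain ⟨φ, hφ, hφadj⟩ := exists_graphH14_hom (G := G) (v0 := a) (v1 := b) (v2 := x) (v3 := y)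
      (v4 := e) (v5 := f) (v6 := g)
      (by
        simp only [List.nodup_cons, List.mem_cons, List.not_mem_nil, or_false, not_or,
          not_false_eq_true, List.nodup_nil, and_true]
        exact ⟨⟨hba.ne', hax, hay, hea, haf, hga⟩,
          ⟨hxb.ne', hby, (hyN he).1.symm, hfb.symm, (hyN hg).1.symm⟩,
          ⟨hxy.ne, hex.symm, hxf.ne, hgx.symm⟩, ⟨he.ne, hfy.symm, hg.ne⟩, ⟨(hyN he).2, heg⟩,
          (hyN hg).2.symm⟩)
      hba.symm hxb.symm hxy he hxf hg
    exact isListed_of_graphH14_hom hG hq hφ hφadj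

/-- If no path of length two leaves the edge in the way treated above, the graph is a double star,
and `x` and `y` cover all its edges. -/
theorem isListed_of_adj (hG : IsPackingCritical G) (htri : TriangleFree G)
    (hcyc : ¬ HasBadCycle G) {x y : V} (hxy : G.Adj x y) (hx : HasThreeNeighbors G x)
    (hy : HasThreeNeighbors G y) : IsListed G := by
  by_contra hL
  have hX : ∀ b a, G.Adj x b → b ≠ y → G.Adj b a → a = x := by
    intro b a hb hby hba
    by_contra hax
    exact hL (isListed_of_adj_of_edge hG htri hcyc hxy hx hy hb hby hba hax)
  have hY : ∀ b a, G.Adj y b → b ≠ x → G.Adj b a → a = y := by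
    intro b a hb hby hba
    by_contra hax
    exact hL (isListed_of_adj_of_edge hG htri hcyc hxy.symm hy hx hb hby hba hax)
  have hS : ∀ v, v ∈ {v | v = x ∨ v = y ∨ G.Adj x v ∨ G.Adj y v} := by
    refine hG.mem_of_closed (a := x) (Or.inl rfl) ?_
    rintro u hu v huv
    by_cases hux : u = x
    · exact Or.inr (Or.inr (Or.inl (hux ▸ huv)))
    by_cases huy : u = y
    · exact Or.inr (Or.inr (Or.inr (huy ▸ huv)))
    rcases hu with hu | hu | hu | hu
    · exact absurd hu hux
    · exact absurd hu huy
    · exact Or.inl (hX u v hu huy huv)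
    · exact Or.inr (Or.inl (hY u v hu hux huv))
  refine hG.not_packable (packable_of_cover x y fun u v huv => ?_)
  by_cases hux : u = x
  · exact Or.inl hux
  by_cases huy : u = y
  · exact Or.inr (Or.inl huy)
  rcases hS u with hu | hu | hu | hu
  · exact absurd hu hux
  · exact absurd hu huy
  · exact Or.inr (Or.inr (Or.inl (hX u v hu huy huv)))
  · exact Or.inr (Or.inr (Or.inr (hY u v hu hux huv)))

theorem isListed_of_triangleFree (hG : IsPackingCritical G) (htri : TriangleFree G) :
    IsListed G := by
  by_cases hcyc : HasBadCycle G
  · exact isListed_of_hasBadCycle hG htri hcyc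
  obtain ⟨x, y, hx, hy, hodd⟩ := hG.exists_odd_dist htri hcyc
  by_cases h1 : G.dist x y = 1
  · exact isListed_of_adj hG htri hcyc (SimpleGraph.dist_eq_one_iff_adj.1 h1) hx hy
  · obtain ⟨p, h0, hd, hp⟩ := exists_isGeodesic hG.connected x y
    exact hp.isListed hG htri hcyc (by omega) hodd (by rwa [h0]) (by rwa [hd])

/-- Avoiding `graphH4` confines the graph to a triangle and its neighbors. Avoiding a cover by two
vertices then gives each triangle vertex a private outside neighbor, hence a copy of `graphH3`. -/
theorem isListed_of_triangle (hG : IsPackingCritical G) {a b c : V} (hab : G.Adj a b)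
    (hbc : G.Adj b c) (hac : G.Adj a c) : IsListed G := by
  by_contra hL
  have h4 : ∀ {a b c d e}, G.Adj a b → G.Adj b c → G.Adj a c → G.Adj b d → G.Adj d e →
      d ≠ a → d ≠ c → e ≠ a → e ≠ b → e = c := by
    intro a b c d e hab hbc hac hbd hde hda hdc hea heb
    by_contra hec
    obtain ⟨φ, hφ, hφadj⟩ := exists_graphH4_hom (G := G) (v0 := a) (v1 := b) (v2 := c) (v3 := d)
      (v4 := e)
      (by
        simp only [List.nodup_cons, List.mem_cons, List.not_mem_nil, or_false, not_or,
          not_false_eq_true, List.nodup_nil, and_true]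
        exact ⟨⟨hab.ne, hac.ne, hda.symm, Ne.symm hea⟩, ⟨hbc.ne, hbd.ne, Ne.symm heb⟩,
          ⟨hdc.symm, Ne.symm hec⟩, hde.ne⟩)
      hab hbc hac.symm hbd hde
    exact hL (isListed_of_graphH4_hom hG hφ hφadj)
  -- neighbors of the triangle have no neighbors outside the triangle
  have hN : ∀ d e, (G.Adj a d ∨ G.Adj b d ∨ G.Adj c d) → d ≠ a → d ≠ b → d ≠ c → G.Adj d e →
      e = a ∨ e = b ∨ e = c := by
    intro d e hd hda hdb hdc hde
    by_contra he
    simp only [not_or] at he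
    obtain ⟨hea, heb, hec⟩ := he
    rcases hd with hd | hd | hd
    · exact hec (h4 hab.symm hac hbc hd hde hdb hdc heb hea)
    · exact hec (h4 hab hbc hac hd hde hda hdc hea heb)
    · exact heb (h4 hac hbc.symm hab hd hde hda hdb hea hec)
  have hS : ∀ v, v ∈ {v | v = a ∨ v = b ∨ v = c ∨ G.Adj a v ∨ G.Adj b v ∨ G.Adj c v} := by
    refine hG.mem_of_closed (a := a) (Or.inl rfl) ?_
    rintro u hu v huv
    simp only [Set.mem_ofPred_eq] at hu ⊢
    by_cases hua : u = a
    · subst hua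
      tauto
    by_cases hub : u = b
    · subst hub
      tauto
    by_cases huc : u = c
    · subst huc
      tauto
    have := hN u v (by tauto) hua hub huc huv
    tauto
  have hE : ∀ u v, G.Adj u v → u = a ∨ u = b ∨ u = c ∨ v = a ∨ v = b ∨ v = c := by
    intro u v huv
    by_contra h
    simp only [not_or] at h
    obtain ⟨h1, h2, h3, h5, h6, h7⟩ := h
    have hu := hS u
    simp only [Set.mem_ofPred_eq] at hu
    have := hN u v (by tauto) h1 h2 h3 huv
    tauto
  -- each vertex of the triangle has a neighbor outside the triangle
  have hout : ∀ {x y z : V}, G.Adj x y → (∀ u v, G.Adj u v → u = x ∨ u = y ∨ u = z ∨ v = x ∨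
      v = y ∨ v = z) → ∃ w, G.Adj z w ∧ w ≠ x ∧ w ≠ y := by
    intro x y z hxy hxyz
    by_contra h
    push Not at h
    refine hG.not_packable (packable_of_cover x y fun u v huv => ?_)
    rcases hxyz u v huv with h' | h' | h' | h' | h' | h'
    · exact Or.inl h'
    · exact Or.inr (Or.inl h')
    · subst h'
      have := h v huv
      tauto
    · exact Or.inr (Or.inr (Or.inl h'))
    · exact Or.inr (Or.inr (Or.inr h'))
    · subst h'
      have := h u huv.symm
      tauto
  obtain ⟨a', haa', ha'b, ha'c⟩ := hout (z := a) hbc fun u v huv => by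
    have := hE u v huv
    tauto
  obtain ⟨b', hbb', hb'a, hb'c⟩ := hout (z := b) hac fun u v huv => by
    have := hE u v huv
    tauto
  obtain ⟨c', hcc', hc'a, hc'b⟩ := hout (z := c) hab hE
  -- two vertices of the triangle have no common neighbor outside the triangle
  have hcommon : ∀ {x y z d z' : V}, G.Adj x y → G.Adj y z → G.Adj x z → G.Adj x d → G.Adj y d →
      d ≠ z → G.Adj z z' → z' ≠ x → z' ≠ y → False := by
    intro x y z d z' hxy hyz hxz hxd hyd hdz hzz' hz'x hz'y
    -- If `z` sees `d`, the four vertices form a complete graph. Otherwise the triangle `x y d` with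
    -- the path `y z z'` is a copy of `graphH4`.
    by_cases hzd : G.Adj z d
    · obtain ⟨φ, hφ, hφadj⟩ := exists_top_four_hom hxy hxz hxd hyz hyd hzd
      have hsurj := hG.surjective not_packable_top_four hφ hφadj
      exact hL (Or.inl (nonempty_iso_of_comap ⟨hφ, hsurj⟩ fun i j =>
        ⟨fun h hij => h.ne (congrArg φ hij), hφadj i j⟩))
    · have := h4 hxy hyd hxd hyz hzz' hxz.ne' hdz.symm hz'x hz'y
      exact hzd (this ▸ hzz')
  have hab' : a' ≠ b' := by
    rintro rfl
    exact hcommon hab hbc hac haa' hbb' ha'c hcc' hc'a hc'b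
  have hac' : a' ≠ c' := by
    rintro rfl
    exact hcommon hac hbc.symm hab haa' hcc' ha'b hbb' hb'a hb'c
  have hbc' : b' ≠ c' := by
    rintro rfl
    exact hcommon hbc hac.symm hab.symm hbb' hcc' hb'a haa' ha'b ha'c
  obtain ⟨φ, hφ, hφadj⟩ := exists_graphH3_hom (G := G) (v0 := a) (v1 := b) (v2 := c) (v3 := a')
    (v4 := b') (v5 := c')
    (by
      simp only [List.nodup_cons, List.mem_cons, List.not_mem_nil, or_false, not_or,
        not_false_eq_true, List.nodup_nil, and_true]
      exact ⟨⟨hab.ne, hac.ne, haa'.ne, hb'a.symm, hc'a.symm⟩,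
        ⟨hbc.ne, ha'b.symm, hbb'.ne, hc'b.symm⟩, ⟨ha'c.symm, hb'c.symm, hcc'.ne⟩,
        ⟨hab', hac'⟩, hbc'⟩)
    hab hbc hac.symm haa' hbb' hcc'
  exact hL (isListed_of_graphH3_hom hG hφ hφadj)

theorem IsPackingCritical.isListed (hG : IsPackingCritical G) : IsListed G := by
  by_cases htri : TriangleFree G
  · exact isListed_of_triangleFree hG htri
  · unfold TriangleFree at htri
    push Not at htri
    obtain ⟨a, b, c, hab, hbc, hac⟩ := htri
    exact isListed_of_triangle hG hab hbc hac

end Branching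

/-! ### The characterization -/

theorem mainTheorem3 (s : ℕ → ℕ) (hs : IsPackingSequence s)
    (hs1 : s 0 = 1) (hs2 : s 1 = 3) (hs3 : s 2 = 3)
    {V : Type*} [Finite V] (G : SimpleGraph V) :
    IsKSVertexCritical s 4 G ↔
      (Nonempty (G ≃g (⊤ : SimpleGraph (Fin 4))) ∨
        (Nonempty (G ≃g graphH1) ∨ Nonempty (G ≃g graphH2) ∨ Nonempty (G ≃g graphH3) ∨
          Nonempty (G ≃g graphH4) ∨ Nonempty (G ≃g graphH5) ∨ Nonempty (G ≃g graphH7) ∨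
          Nonempty (G ≃g graphH14) ∨ Nonempty (G ≃g graphH15)) ∨
        (∃ H ∈ familyC5, Nonempty (G ≃g H)) ∨
        (∃ H ∈ familyC6, Nonempty (G ≃g H)) ∨
        (∃ n : ℕ, 5 ≤ n ∧ (n % 4 = 1 ∨ n % 4 = 2 ∨ (n % 4 = 3 ∧ s 3 < n / 2)) ∧
          Nonempty (G ≃g SimpleGraph.cycleGraph n)) ∨
        (∃ k : ℕ, 3 ≤ k ∧ Nonempty (G ≃g graphG k))) := by
  constructor
  · intro h
    obtain ⟨h1, h2, -⟩ := (isKSVertexCritical_four_iff hs1 hs2 hs3).1 h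
    refine (IsPackingCritical.mk h1 h2).isListed.imp_right (Or.imp_right (Or.imp_right
      (Or.imp_right (Or.imp_left ?_))))
    rintro ⟨n, hn, hn4, ⟨e⟩⟩
    refine ⟨n, hn, ?_, ⟨e⟩⟩
    -- Only here is the four-coloring needed in this direction: transported to the cycle, it yields
    -- the bound on `s 3`.
    by_cases h3 : n % 4 = 3
    · obtain ⟨-, -, c, hc⟩ := (isKSVertexCritical_four_iff hs1 hs2 hs3).1
        (isKSVertexCritical_four_of_iso hs1 hs2 hs3 e.symm h)
      exact Or.inr (Or.inr ⟨h3, lt_half_of_four_coloring hs1 hs2 hs3 hn h3 hc⟩)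
    · omega
  · have key : ∀ {W : Type} {H : SimpleGraph W}, IsKSVertexCritical s 4 H → Nonempty (G ≃g H) →
        IsKSVertexCritical s 4 G := fun h ⟨e⟩ => isKSVertexCritical_four_of_iso hs1 hs2 hs3 e h
    rintro (h | (h | h | h | h | h | h | h | h) | ⟨H, hH, h⟩ | ⟨H, hH, h⟩ | ⟨n, hn, hn4, h⟩ |
      ⟨k, hk, h⟩)
    · exact key (isKSVertexCritical_top_four hs1 hs2 hs3) h
    · exact key (isKSVertexCritical_H1 hs1 hs2 hs3) h
    · exact key (isKSVertexCritical_H2 hs1 hs2 hs3) h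
    · exact key (isKSVertexCritical_H3 hs1 hs2 hs3) h
    · exact key (isKSVertexCritical_H4 hs1 hs2 hs3) h
    · exact key (isKSVertexCritical_H5 hs1 hs2 hs3) h
    · exact key (isKSVertexCritical_H7 hs1 hs2 hs3) h
    · exact key (isKSVertexCritical_H14 hs1 hs2 hs3) h
    · exact key (isKSVertexCritical_H15 hs1 hs2 hs3) h
    · simp only [familyC5, Set.mem_insert_iff, Set.mem_singleton_iff] at hH
      rcases hH with rfl | rfl | rfl | rfl
      · exact key (isKSVertexCritical_C5a hs1 hs2 hs3) h
      · exact key (isKSVertexCritical_C5b hs1 hs2 hs3) h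
      · exact key (isKSVertexCritical_C5c hs1 hs2 hs3) h
      · exact key (isKSVertexCritical_C5d hs1 hs2 hs3) h
    · simp only [familyC6, Set.mem_insert_iff, Set.mem_singleton_iff] at hH
      rcases hH with rfl | rfl | rfl
      · exact key (isKSVertexCritical_C6a hs1 hs2 hs3) h
      · exact key (isKSVertexCritical_C6b hs1 hs2 hs3) h
      · exact key (isKSVertexCritical_C6c hs1 hs2 hs3) h
    · exact key (isKSVertexCritical_cycleGraph hs1 hs2 hs3 hn hn4) h
    · exact key (isKSVertexCritical_graphG hs1 hs2 hs3 hk) h
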